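/- Let $a,b>0$ and let $\xi\in(0,1)$ be irrational. Let $\mathcal H=[H^2(0,1)\cap H^1_0(0,1)]\times L^2(0,1)$ (complex-valued functions) with inner product $(U_1,U_2)_{\mathcal H}=\int_0^1\big(a\,u_1''\,\overline{u_2''}+v_1\overline{v_2}\big)\,dx$ for $U_i=(u_i,v_i)$. For $\alpha\ge 0$ let $\mathcal A=\mathcal A_\alpha$ be the unbounded operator in $\mathcal H$ whose domain $D(\mathcal A_\alpha)$ consists of all $(u,v)\in\mathcal H$ with $u\in H^4(0,\xi)\cap H^4(\xi,1)\cap H^2(0,1)$, $v\in H^2(0,1)$, and $$u(0)=v(0)=u(1)=v(1)=0,\quad u''(0)=u''(1)=0,\quad u''(\xi^-)=u''(\xi^+),\quad u'''(\xi^+)-u'''(\xi^-)=-\frac{\alpha}{a}\,v(\xi),$$ and which is given by $\mathcal A_\alpha(u,v)=\big(v,\,-a\,u''''-b\,v-\alpha\,v(\xi)\,\delta_\xi\big)$ in the sense of distributions on $(0,1)$; equivalently, the second component is the $L^2$ function $-a\,u''''-b\,v$ with $u''''$ taken on $(0,\xi)$ and on $(\xi,1)$ separately. Then: (1) For $\alpha=0$,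 the spectrum $\sigma(\mathcal A_0)$ satisfies $$\sup_{\mu\in\sigma(\mathcal A_0)}\operatorname{Re}\mu=\omega,\qquad \omega:=\begin{cases}-\dfrac b2 & \text{if } b\le 2\sqrt a\,\pi^2,\\[2mm] \dfrac12\left(-b+\sqrt{b^2-4a\pi^4}\right) & \text{if } b>2\sqrt a\,\pi^2.\end{cases}$$ (2) For every $\varepsilon>0$ there exists $\alpha_0>0$ such that for every $\alpha$ with $0<\alpha<\alpha_0$ every eigenvalue $\mu$ of $\mathcal A_\alpha$ satisfies $\operatorname{Re}\mu\le\omega+\varepsilon$. -/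

import Mathlib

open MeasureTheory Set
open scoped ContDiff

/-- `w` is the weak derivative of order `k` of `u` on the open set `Ω ⊆ ℝ`. -/
structure HasWeakDeriv (Ω : Set ℝ) (k : ℕ) (u w : ℝ → ℂ) : Prop where
  locInt : LocallyIntegrableOn u Ω
  locInt' : LocallyIntegrableOn w Ω
  integral_eq : ∀ φ : ℝ → ℝ, ContDiff ℝ ∞ φ → HasCompactSupport φ → tsupport φ ⊆ Ω →
    ∫ x in Ω, iteratedDeriv k φ x • u x = (-1 : ℂ) ^ k * ∫ x in Ω, φ x • w x

/-- `u` belongs to the complex Sobolev space `H^k(Ω)`: for every `j ≤ k` the weak derivative of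
order `j` of `u` exists and lies in `L²(Ω)` (for `j = 0` this says `u ∈ L²(Ω)`). -/
def MemHk (Ω : Set ℝ) (k : ℕ) (u : ℝ → ℂ) : Prop :=
  ∀ j ≤ k, ∃ w : ℝ → ℂ, MemLp w 2 (volume.restrict Ω) ∧ HasWeakDeriv Ω j u w

/-- The weak derivative of order `j` of `u` on `(c, d)` has a representative that is continuous
on `[c, d]` and takes the value `y` at `x`.  For `x = c` or `x = d` this is the one-sided value
`u^{(j)}(c⁺) = y`, respectively `u^{(j)}(d⁻) = y`; for `j = 0` it concerns `u` itself. -/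
def HasTrace (c d : ℝ) (j : ℕ) (u : ℝ → ℂ) (x : ℝ) (y : ℂ) : Prop :=
  ∃ g : ℝ → ℂ, ContinuousOn g (Icc c d) ∧ HasWeakDeriv (Ioo c d) j u g ∧ g x = y

theorem hasWeakDeriv_zero (Ω : Set ℝ) (k : ℕ) :
    HasWeakDeriv Ω k (fun _ => (0 : ℂ)) (fun _ => (0 : ℂ)) where
  locInt := (integrableOn_zero).locallyIntegrableOn
  locInt' := (integrableOn_zero).locallyIntegrableOn
  integral_eq := by intro φ _ _ _; simp

theorem HasWeakDeriv.smul {Ω : Set ℝ} {k : ℕ} {u w : ℝ → ℂ} (c : ℂ)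
    (h : HasWeakDeriv Ω k u w) :
    HasWeakDeriv Ω k (fun x => c * u x) (fun x => c * w x) where
  locInt := fun x hx => (h.locInt x hx).smul c
  locInt' := fun x hx => (h.locInt' x hx).smul c
  integral_eq := by
    intro φ h1 h2 h3
    have e := h.integral_eq φ h1 h2 h3
    have e1 : ∀ (f : ℝ → ℝ) (g : ℝ → ℂ),
        ∫ x in Ω, f x • (c * g x) = c * ∫ x in Ω, f x • g x := by
      intro f g
      rw [← integral_const_mul]
      congr 1
      funext x
      simp only [Complex.real_smul]
      ring
    rw [e1, e1, e]
    ring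

/-- A continuous function with compact support in the open set `Ω` times a locally integrable
function on `Ω` is integrable on `Ω`. -/
theorem integrableOn_test_smul {Ω : Set ℝ} (hΩ : IsOpen Ω) {u : ℝ → ℂ}
    (hu : LocallyIntegrableOn u Ω) {f : ℝ → ℝ} (hf : Continuous f)
    (hc : HasCompactSupport f) (hs : tsupport f ⊆ Ω) :
    IntegrableOn (fun x => f x • u x) Ω := by
  have h1 : IntegrableOn u (tsupport f) := hu.integrableOn_compact_subset hs hc
  have h2 : IntegrableOn (fun x => f x • u x) (tsupport f) :=
    h1.continuousOn_smul hf.continuousOn hc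
  refine (h2.of_forall_sdiff_eq_zero hΩ.measurableSet ?_)
  intro x hx
  simp [image_eq_zero_of_notMem_tsupport hx.2]

theorem HasWeakDeriv.add {Ω : Set ℝ} (hΩ : IsOpen Ω) {k : ℕ} {u₁ w₁ u₂ w₂ : ℝ → ℂ}
    (h₁ : HasWeakDeriv Ω k u₁ w₁) (h₂ : HasWeakDeriv Ω k u₂ w₂) :
    HasWeakDeriv Ω k (fun x => u₁ x + u₂ x) (fun x => w₁ x + w₂ x) where
  locInt := h₁.locInt.add h₂.locInt
  locInt' := h₁.locInt'.add h₂.locInt'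
  integral_eq := by
    intro φ h1 h2 h3
    have hc : Continuous (iteratedDeriv k φ) :=
      h1.continuous_iteratedDeriv k (by exact_mod_cast le_top)
    have hts : tsupport (iteratedDeriv k φ) ⊆ tsupport φ := by
      refine closure_minimal ?_ (isClosed_tsupport φ)
      intro x hx
      have : x ∈ Function.support (iteratedFDeriv ℝ k φ) := by
        intro h0
        apply hx
        rw [iteratedDeriv_eq_iteratedFDeriv, h0]
        simp
      exact support_iteratedFDeriv_subset k this
    have hcs : HasCompactSupport (iteratedDeriv k φ) :=
      h2.of_isClosed_subset (isClosed_tsupport _) hts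
    simp only [smul_add]
    rw [integral_add (integrableOn_test_smul hΩ h₁.locInt hc hcs (hts.trans h3))
        (integrableOn_test_smul hΩ h₂.locInt hc hcs (hts.trans h3)),
      integral_add (integrableOn_test_smul hΩ h₁.locInt' h1.continuous h2 h3)
        (integrableOn_test_smul hΩ h₂.locInt' h1.continuous h2 h3),
      h₁.integral_eq φ h1 h2 h3, h₂.integral_eq φ h1 h2 h3]
    ring

theorem locallyIntegrableOn_congr_ae {Ω : Set ℝ} {u u' : ℝ → ℂ}
    (h : LocallyIntegrableOn u Ω) (hu : u =ᵐ[volume.restrict Ω] u') :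
    LocallyIntegrableOn u' Ω := by
  intro x hx
  obtain ⟨t, ht, hi⟩ := h x hx
  refine ⟨t ∩ Ω, Filter.inter_mem ht self_mem_nhdsWithin, ?_⟩
  exact (hi.mono_set inter_subset_left).congr_fun_ae
    (ae_restrict_of_ae_restrict_of_subset inter_subset_right hu)

theorem HasWeakDeriv.congr {Ω : Set ℝ} {k : ℕ} {u w u' w' : ℝ → ℂ}
    (h : HasWeakDeriv Ω k u w) (hu : u =ᵐ[volume.restrict Ω] u')
    (hw : w =ᵐ[volume.restrict Ω] w') : HasWeakDeriv Ω k u' w' where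
  locInt := locallyIntegrableOn_congr_ae h.locInt hu
  locInt' := locallyIntegrableOn_congr_ae h.locInt' hw
  integral_eq := by
    intro φ h1 h2 h3
    have e1 : ∫ x in Ω, iteratedDeriv k φ x • u' x = ∫ x in Ω, iteratedDeriv k φ x • u x :=
      integral_congr_ae (hu.mono fun x hx => by simp only [hx])
    have e2 : ∫ x in Ω, φ x • w' x = ∫ x in Ω, φ x • w x :=
      integral_congr_ae (hw.mono fun x hx => by simp only [hx])
    rw [e1, e2]
    exact h.integral_eq φ h1 h2 h3

theorem HasWeakDeriv.ae_unique {Ω : Set ℝ} (hΩ : IsOpen Ω) {k : ℕ} {u w w' : ℝ → ℂ}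
    (h : HasWeakDeriv Ω k u w) (h' : HasWeakDeriv Ω k u w') :
    ∀ᵐ x, x ∈ Ω → w x = w' x := by
  have key := hΩ.ae_eq_zero_of_integral_contDiff_smul_eq_zero (h.locInt'.sub h'.locInt') (by
    intro φ h1 h2 h3
    have i1 := integrableOn_test_smul hΩ h.locInt' h1.continuous h2 h3
    have i2 := integrableOn_test_smul hΩ h'.locInt' h1.continuous h2 h3
    have e := (h.integral_eq φ h1 h2 h3).symm.trans (h'.integral_eq φ h1 h2 h3)
    have e' : ∫ x in Ω, φ x • w x = ∫ x in Ω, φ x • w' x :=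
      mul_left_cancel₀ (pow_ne_zero k (by norm_num)) e
    rw [← setIntegral_eq_integral_of_forall_compl_eq_zero (s := Ω)]
    · simp only [Pi.sub_apply, smul_sub]
      rw [integral_sub i1 i2, e', sub_self]
    · intro x hx
      rw [image_eq_zero_of_notMem_tsupport (fun hx' => hx (h3 hx')), zero_smul])
  filter_upwards [key] with x hx hxΩ
  exact sub_eq_zero.mp (hx hxΩ)

theorem MemHk.congr {Ω : Set ℝ} {k : ℕ} {u u' : ℝ → ℂ} (h : MemHk Ω k u)
    (hu : u =ᵐ[volume.restrict Ω] u') : MemHk Ω k u' := by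
  intro j hj
  obtain ⟨w, hw, hd⟩ := h j hj
  exact ⟨w, hw, hd.congr hu (Filter.EventuallyEq.refl _ _)⟩

theorem MemHk.add {Ω : Set ℝ} (hΩ : IsOpen Ω) {k : ℕ} {u₁ u₂ : ℝ → ℂ} (h₁ : MemHk Ω k u₁)
    (h₂ : MemHk Ω k u₂) : MemHk Ω k (fun x => u₁ x + u₂ x) := by
  intro j hj
  obtain ⟨w₁, hw₁, hd₁⟩ := h₁ j hj
  obtain ⟨w₂, hw₂, hd₂⟩ := h₂ j hj
  exact ⟨_, hw₁.add hw₂, hd₁.add hΩ hd₂⟩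

theorem MemHk.smul {Ω : Set ℝ} {k : ℕ} {u : ℝ → ℂ} (c : ℂ) (h : MemHk Ω k u) :
    MemHk Ω k (fun x => c * u x) := by
  intro j hj
  obtain ⟨w, hw, hd⟩ := h j hj
  exact ⟨_, hw.const_mul c, hd.smul c⟩

theorem memHk_zero (Ω : Set ℝ) (k : ℕ) : MemHk Ω k (fun _ => (0 : ℂ)) :=
  fun j _ => ⟨_, MemLp.zero, hasWeakDeriv_zero Ω j⟩

theorem HasTrace.congr {c d : ℝ} {j : ℕ} {u u' : ℝ → ℂ} {x : ℝ} {y : ℂ}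
    (h : HasTrace c d j u x y) (hu : u =ᵐ[volume.restrict (Ioo c d)] u') :
    HasTrace c d j u' x y := by
  obtain ⟨g, hg, hd, he⟩ := h
  exact ⟨g, hg, hd.congr hu (Filter.EventuallyEq.refl _ _), he⟩

theorem HasTrace.add {c d : ℝ} {j : ℕ} {u₁ u₂ : ℝ → ℂ} {x : ℝ} {y₁ y₂ : ℂ}
    (h₁ : HasTrace c d j u₁ x y₁) (h₂ : HasTrace c d j u₂ x y₂) :
    HasTrace c d j (fun x => u₁ x + u₂ x) x (y₁ + y₂) := by
  obtain ⟨g₁, hg₁, hd₁, he₁⟩ := h₁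
  obtain ⟨g₂, hg₂, hd₂, he₂⟩ := h₂
  exact ⟨_, hg₁.add hg₂, hd₁.add isOpen_Ioo hd₂, by simp [he₁, he₂]⟩

theorem HasTrace.smul {c d : ℝ} {j : ℕ} {u : ℝ → ℂ} {x : ℝ} {y : ℂ} (r : ℂ)
    (h : HasTrace c d j u x y) : HasTrace c d j (fun x => r * u x) x (r * y) := by
  obtain ⟨g, hg, hd, he⟩ := h
  exact ⟨_, hg.const_smul r, hd.smul r, by simp [he]⟩

theorem hasTrace_zero (c d : ℝ) (j : ℕ) (x : ℝ) : HasTrace c d j (fun _ => (0 : ℂ)) x 0 :=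
  ⟨_, continuousOn_const, hasWeakDeriv_zero _ j, rfl⟩

/-- The complex Hilbert space `L²(0, 1)`. -/
abbrev L2I : Type := Lp ℂ 2 (volume.restrict (Ioo (0 : ℝ) 1))

theorem L2I.ae_of_subset {Ω : Set ℝ} (hΩ : Ω ⊆ Ioo 0 1) {p : ℝ → Prop}
    (h : ∀ᵐ x ∂(volume.restrict (Ioo (0 : ℝ) 1)), p x) : ∀ᵐ x ∂(volume.restrict Ω), p x :=
  ae_restrict_of_ae_restrict_of_subset hΩ h

theorem L2I.coe_add {Ω : Set ℝ} (hΩ : Ω ⊆ Ioo 0 1) (u v : L2I) :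
    (fun x => u x + v x) =ᵐ[volume.restrict Ω] ((u + v : L2I) : ℝ → ℂ) :=
  L2I.ae_of_subset hΩ (Lp.coeFn_add u v).symm

theorem L2I.coe_smul {Ω : Set ℝ} (hΩ : Ω ⊆ Ioo 0 1) (c : ℂ) (u : L2I) :
    (fun x => c * u x) =ᵐ[volume.restrict Ω] ((c • u : L2I) : ℝ → ℂ) :=
  L2I.ae_of_subset hΩ (Lp.coeFn_smul c u).symm

theorem L2I.coe_zero {Ω : Set ℝ} (hΩ : Ω ⊆ Ioo 0 1) :
    (fun _ => (0 : ℂ)) =ᵐ[volume.restrict Ω] ((0 : L2I) : ℝ → ℂ) :=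
  L2I.ae_of_subset hΩ (Lp.coeFn_zero ℂ 2 _).symm

/-- The energy space `[H²(0, 1) ∩ H¹₀(0, 1)] × L²(0, 1)`; in one dimension membership of an
`H²` function in `H¹₀` means that its continuous representative vanishes at `0` and `1`. -/
def energySpace : Submodule ℂ (L2I × L2I) where
  carrier := {U | MemHk (Ioo 0 1) 2 U.1 ∧ HasTrace 0 1 0 U.1 0 0 ∧ HasTrace 0 1 0 U.1 1 0}
  zero_mem' :=
    have e := L2I.coe_zero (le_refl (Ioo (0 : ℝ) 1))
    ⟨(memHk_zero _ _).congr e, (hasTrace_zero _ _ _ _).congr e, (hasTrace_zero _ _ _ _).congr e⟩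
  add_mem' := by
    rintro U V ⟨h1, h2, h3⟩ ⟨k1, k2, k3⟩
    have e := L2I.coe_add (le_refl (Ioo (0 : ℝ) 1)) U.1 V.1
    exact ⟨(h1.add isOpen_Ioo k1).congr e, by simpa using (h2.add k2).congr e,
      by simpa using (h3.add k3).congr e⟩
  smul_mem' := by
    rintro c U ⟨h1, h2, h3⟩
    have e := L2I.coe_smul (le_refl (Ioo (0 : ℝ) 1)) c U.1
    exact ⟨(h1.smul c).congr e, by simpa using (h2.smul c).congr e,
      by simpa using (h3.smul c).congr e⟩

open Classical in
/-- The second weak derivative `u_xx ∈ L²(0, 1)` of `u ∈ H²(0, 1)` (it is unique in `L²`). -/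
noncomputable def secondDeriv (u : L2I) : L2I :=
  if h : ∃ w : L2I, HasWeakDeriv (Ioo 0 1) 2 u w then h.choose else 0

/-- The inner product `∫₀¹ (a u₁_xx conj(u₂_xx) + v₁ conj(v₂)) dx` of the energy space. -/
noncomputable def energyInner (a : ℝ) (U₁ U₂ : energySpace) : ℂ :=
  a * inner ℂ (secondDeriv U₂.1.1) (secondDeriv U₁.1.1) + inner ℂ U₂.1.2 U₁.1.2

/-- The norm of the energy space. -/
noncomputable def energyNorm (a : ℝ) (U : energySpace) : ℝ :=
  Real.sqrt (energyInner a U U).re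

/-- `w` is the fourth weak derivative of `u` on each of the intervals `(0, ξ)` and `(ξ, 1)`. -/
def IsFourthDeriv (ξ : ℝ) (u w : L2I) : Prop :=
  HasWeakDeriv (Ioo 0 ξ) 4 u w ∧ HasWeakDeriv (Ioo ξ 1) 4 u w

theorem IsFourthDeriv.unique {ξ : ℝ} {u w w' : L2I} (h : IsFourthDeriv ξ u w)
    (h' : IsFourthDeriv ξ u w') : w = w' := by
  apply Lp.ext
  rw [Filter.EventuallyEq, ae_restrict_iff' measurableSet_Ioo]
  have hne : ∀ᵐ x : ℝ, x ≠ ξ := by simp [ae_iff]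
  filter_upwards [h.1.ae_unique isOpen_Ioo h'.1, h.2.ae_unique isOpen_Ioo h'.2, hne]
    with x h1 h2 h3 hx
  rcases lt_or_gt_of_ne h3 with hlt | hlt
  · exact h1 ⟨hx.1, hlt⟩
  · exact h2 ⟨hlt, hx.2⟩

theorem left_subset {ξ : ℝ} (hξ : ξ ∈ Ioo (0 : ℝ) 1) : Ioo 0 ξ ⊆ Ioo (0 : ℝ) 1 :=
  Ioo_subset_Ioo_right hξ.2.le

theorem right_subset {ξ : ℝ} (hξ : ξ ∈ Ioo (0 : ℝ) 1) : Ioo ξ 1 ⊆ Ioo (0 : ℝ) 1 :=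
  Ioo_subset_Ioo_left hξ.1.le

theorem IsFourthDeriv.add {ξ : ℝ} (hξ : ξ ∈ Ioo (0 : ℝ) 1) {u₁ u₂ w₁ w₂ : L2I}
    (h₁ : IsFourthDeriv ξ u₁ w₁) (h₂ : IsFourthDeriv ξ u₂ w₂) :
    IsFourthDeriv ξ (u₁ + u₂) (w₁ + w₂) :=
  ⟨(h₁.1.add isOpen_Ioo h₂.1).congr (L2I.coe_add (left_subset hξ) _ _)
      (L2I.coe_add (left_subset hξ) _ _),
    (h₁.2.add isOpen_Ioo h₂.2).congr (L2I.coe_add (right_subset hξ) _ _)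
      (L2I.coe_add (right_subset hξ) _ _)⟩

theorem IsFourthDeriv.smul {ξ : ℝ} (hξ : ξ ∈ Ioo (0 : ℝ) 1) {u w : L2I} (c : ℂ)
    (h : IsFourthDeriv ξ u w) : IsFourthDeriv ξ (c • u) (c • w) :=
  ⟨(h.1.smul c).congr (L2I.coe_smul (left_subset hξ) _ _) (L2I.coe_smul (left_subset hξ) _ _),
    (h.2.smul c).congr (L2I.coe_smul (right_subset hξ) _ _)
      (L2I.coe_smul (right_subset hξ) _ _)⟩

theorem exists_isFourthDeriv {ξ : ℝ} (hξ : ξ ∈ Ioo (0 : ℝ) 1) {u : L2I}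
    (h₁ : MemHk (Ioo 0 ξ) 4 u) (h₂ : MemHk (Ioo ξ 1) 4 u) : ∃ w : L2I, IsFourthDeriv ξ u w := by
  obtain ⟨w₁, hw₁, hd₁⟩ := h₁ 4 le_rfl
  obtain ⟨w₂, hw₂, hd₂⟩ := h₂ 4 le_rfl
  have m₁ : MemLp ((Ioo 0 ξ).indicator w₁) 2 (volume.restrict (Ioo (0 : ℝ) 1)) :=
    ((memLp_indicator_iff_restrict measurableSet_Ioo).2 hw₁).restrict _
  have m₂ : MemLp ((Ioo ξ 1).indicator w₂) 2 (volume.restrict (Ioo (0 : ℝ) 1)) :=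
    ((memLp_indicator_iff_restrict measurableSet_Ioo).2 hw₂).restrict _
  have hc := (m₁.add m₂).coeFn_toLp
  refine ⟨(m₁.add m₂).toLp _, hd₁.congr (Filter.EventuallyEq.refl _ _) ?_,
    hd₂.congr (Filter.EventuallyEq.refl _ _) ?_⟩
  · filter_upwards [L2I.ae_of_subset (left_subset hξ) hc, ae_restrict_mem measurableSet_Ioo]
      with x hx hxm
    rw [hx, Pi.add_apply, indicator_of_mem hxm,
      indicator_of_notMem (fun h => absurd h.1 (not_lt.2 hxm.2.le)), add_zero]
  · filter_upwards [L2I.ae_of_subset (right_subset hξ) hc, ae_restrict_mem measurableSet_Ioo]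
      with x hx hxm
    rw [hx, Pi.add_apply, indicator_of_mem hxm,
      indicator_of_notMem (fun h => absurd h.2 (not_lt.2 hxm.1.le)), zero_add]

/-- The conditions that define the domain of the beam operator, for `U = (u, v)`. -/
structure InBeamDomain (a α ξ : ℝ) (u v : L2I) : Prop where
  u_left : MemHk (Ioo 0 ξ) 4 u
  u_right : MemHk (Ioo ξ 1) 4 u
  u_H2 : MemHk (Ioo 0 1) 2 u
  v_H2 : MemHk (Ioo 0 1) 2 v
  u_zero : HasTrace 0 1 0 u 0 0
  u_one : HasTrace 0 1 0 u 1 0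
  v_zero : HasTrace 0 1 0 v 0 0
  v_one : HasTrace 0 1 0 v 1 0
  uxx_zero : HasTrace 0 ξ 2 u 0 0
  uxx_one : HasTrace ξ 1 2 u 1 0
  /-- `u_xx(ξ⁻) = u_xx(ξ⁺)` -/
  uxx_cont : ∃ m : ℂ, HasTrace 0 ξ 2 u ξ m ∧ HasTrace ξ 1 2 u ξ m
  /-- `u_xxx(ξ⁺) - u_xxx(ξ⁻) = -(α / a) v(ξ)` -/
  uxxx_jump : ∃ p m y : ℂ, HasTrace ξ 1 3 u ξ p ∧ HasTrace 0 ξ 3 u ξ m ∧ HasTrace 0 1 0 v ξ y ∧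
    p - m = -(α / a) * y

/-- The domain `D(𝒜)` of the beam operator. -/
def beamDomain (a α ξ : ℝ) (hξ : ξ ∈ Ioo (0 : ℝ) 1) : Submodule ℂ energySpace where
  carrier := {U | InBeamDomain a α ξ U.1.1 U.1.2}
  zero_mem' := by
    have e := L2I.coe_zero (le_refl (Ioo (0 : ℝ) 1))
    have e1 := L2I.coe_zero (left_subset hξ)
    have e2 := L2I.coe_zero (right_subset hξ)
    exact
    { u_left := (memHk_zero _ _).congr e1
      u_right := (memHk_zero _ _).congr e2
      u_H2 := (memHk_zero _ _).congr e
      v_H2 := (memHk_zero _ _).congr e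
      u_zero := (hasTrace_zero _ _ _ _).congr e
      u_one := (hasTrace_zero _ _ _ _).congr e
      v_zero := (hasTrace_zero _ _ _ _).congr e
      v_one := (hasTrace_zero _ _ _ _).congr e
      uxx_zero := (hasTrace_zero _ _ _ _).congr e1
      uxx_one := (hasTrace_zero _ _ _ _).congr e2
      uxx_cont := ⟨0, (hasTrace_zero _ _ _ _).congr e1, (hasTrace_zero _ _ _ _).congr e2⟩
      uxxx_jump := ⟨0, 0, 0, (hasTrace_zero _ _ _ _).congr e2, (hasTrace_zero _ _ _ _).congr e1,
        (hasTrace_zero _ _ _ _).congr e, by simp⟩ }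
  add_mem' := by
    intro U V h k
    have eu := L2I.coe_add (le_refl (Ioo (0 : ℝ) 1)) U.1.1 V.1.1
    have ev := L2I.coe_add (le_refl (Ioo (0 : ℝ) 1)) U.1.2 V.1.2
    have e1 := L2I.coe_add (left_subset hξ) U.1.1 V.1.1
    have e2 := L2I.coe_add (right_subset hξ) U.1.1 V.1.1
    obtain ⟨m, hm1, hm2⟩ := h.uxx_cont
    obtain ⟨m', km1, km2⟩ := k.uxx_cont
    obtain ⟨p, q, y, hp, hq, hy, hj⟩ := h.uxxx_jump
    obtain ⟨p', q', y', kp, kq, ky, kj⟩ := k.uxxx_jump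
    exact
    { u_left := (h.u_left.add isOpen_Ioo k.u_left).congr e1
      u_right := (h.u_right.add isOpen_Ioo k.u_right).congr e2
      u_H2 := (h.u_H2.add isOpen_Ioo k.u_H2).congr eu
      v_H2 := (h.v_H2.add isOpen_Ioo k.v_H2).congr ev
      u_zero := by simpa using (h.u_zero.add k.u_zero).congr eu
      u_one := by simpa using (h.u_one.add k.u_one).congr eu
      v_zero := by simpa using (h.v_zero.add k.v_zero).congr ev
      v_one := by simpa using (h.v_one.add k.v_one).congr ev
      uxx_zero := by simpa using (h.uxx_zero.add k.uxx_zero).congr e1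
      uxx_one := by simpa using (h.uxx_one.add k.uxx_one).congr e2
      uxx_cont := ⟨_, (hm1.add km1).congr e1, (hm2.add km2).congr e2⟩
      uxxx_jump := ⟨_, _, _, (hp.add kp).congr e2, (hq.add kq).congr e1, (hy.add ky).congr ev,
        by linear_combination hj + kj⟩ }
  smul_mem' := by
    intro c U h
    have eu := L2I.coe_smul (le_refl (Ioo (0 : ℝ) 1)) c U.1.1
    have ev := L2I.coe_smul (le_refl (Ioo (0 : ℝ) 1)) c U.1.2
    have e1 := L2I.coe_smul (left_subset hξ) c U.1.1
    have e2 := L2I.coe_smul (right_subset hξ) c U.1.1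
    obtain ⟨m, hm1, hm2⟩ := h.uxx_cont
    obtain ⟨p, q, y, hp, hq, hy, hj⟩ := h.uxxx_jump
    exact
    { u_left := (h.u_left.smul c).congr e1
      u_right := (h.u_right.smul c).congr e2
      u_H2 := (h.u_H2.smul c).congr eu
      v_H2 := (h.v_H2.smul c).congr ev
      u_zero := by simpa using (h.u_zero.smul c).congr eu
      u_one := by simpa using (h.u_one.smul c).congr eu
      v_zero := by simpa using (h.v_zero.smul c).congr ev
      v_one := by simpa using (h.v_one.smul c).congr ev
      uxx_zero := by simpa using (h.uxx_zero.smul c).congr e1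
      uxx_one := by simpa using (h.uxx_one.smul c).congr e2
      uxx_cont := ⟨_, (hm1.smul c).congr e1, (hm2.smul c).congr e2⟩
      uxxx_jump := ⟨_, _, _, (hp.smul c).congr e2, (hq.smul c).congr e1, (hy.smul c).congr ev,
        by linear_combination c * hj⟩ }

theorem beamDomain_exists {a α ξ : ℝ} (hξ : ξ ∈ Ioo (0 : ℝ) 1) (U : beamDomain a α ξ hξ) :
    ∃ w : L2I, IsFourthDeriv ξ U.1.1.1 w :=
  exists_isFourthDeriv hξ U.2.u_left U.2.u_right

/-- The fourth derivative of `u` off the point `ξ`, for `(u, v) ∈ D(𝒜)`. -/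
noncomputable def fourthDeriv {a α ξ : ℝ} (hξ : ξ ∈ Ioo (0 : ℝ) 1) (U : beamDomain a α ξ hξ) :
    L2I :=
  (beamDomain_exists hξ U).choose

theorem fourthDeriv_spec {a α ξ : ℝ} (hξ : ξ ∈ Ioo (0 : ℝ) 1) (U : beamDomain a α ξ hξ) :
    IsFourthDeriv ξ U.1.1.1 (fourthDeriv hξ U) :=
  (beamDomain_exists hξ U).choose_spec

theorem fourthDeriv_add {a α ξ : ℝ} (hξ : ξ ∈ Ioo (0 : ℝ) 1) (U V : beamDomain a α ξ hξ) :
    fourthDeriv hξ (U + V) = fourthDeriv hξ U + fourthDeriv hξ V :=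
  (fourthDeriv_spec hξ (U + V)).unique ((fourthDeriv_spec hξ U).add hξ (fourthDeriv_spec hξ V))

theorem fourthDeriv_smul {a α ξ : ℝ} (hξ : ξ ∈ Ioo (0 : ℝ) 1) (c : ℂ)
    (U : beamDomain a α ξ hξ) : fourthDeriv hξ (c • U) = c • fourthDeriv hξ U :=
  (fourthDeriv_spec hξ (c • U)).unique ((fourthDeriv_spec hξ U).smul hξ c)

/-- `fourthDeriv` as a linear map on `D(𝒜)`. -/
noncomputable def fourthDerivL {a α ξ : ℝ} (hξ : ξ ∈ Ioo (0 : ℝ) 1) :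
    beamDomain a α ξ hξ →ₗ[ℂ] L2I where
  toFun := fourthDeriv hξ
  map_add' := fourthDeriv_add hξ
  map_smul' := fourthDeriv_smul hξ

/-- The linear map `(u, v) ↦ v` on `D(𝒜)`. -/
noncomputable def velocityL {a α ξ : ℝ} (hξ : ξ ∈ Ioo (0 : ℝ) 1) : beamDomain a α ξ hξ →ₗ[ℂ] L2I :=
  (LinearMap.snd ℂ L2I L2I ∘ₗ energySpace.subtype) ∘ₗ (beamDomain a α ξ hξ).subtype

/-- The unbounded operator `𝒜(u, v) = (v, -a u_xxxx - b v - α v(ξ) δ_ξ)` in the energy space,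
with domain `D(𝒜)`.  As a distribution on `(0, 1)`, `u_xxxx` is the sum of the `L²` function
`fourthDeriv` (the fourth derivative on `(0, ξ)` and on `(ξ, 1)`) and of
`(u_xxx(ξ⁺) - u_xxx(ξ⁻)) δ_ξ`, and by the jump condition `-a` times the latter cancels
`-α v(ξ) δ_ξ`; what remains is the `L²` function in the second component. -/
noncomputable def beamOperator (a b α ξ : ℝ) (hξ : ξ ∈ Ioo (0 : ℝ) 1) :
    energySpace →ₗ.[ℂ] energySpace where
  domain := beamDomain a α ξ hξ
  toFun := LinearMap.codRestrict energySpace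
    ((velocityL hξ).prod (-((a : ℂ) • fourthDerivL hξ) - (b : ℂ) • velocityL hξ))
    (fun U => ⟨U.2.v_H2, U.2.v_zero, U.2.v_one⟩)

theorem beamOperator_fst (a b α ξ : ℝ) (hξ : ξ ∈ Ioo (0 : ℝ) 1) (U : beamDomain a α ξ hξ) :
    (beamOperator a b α ξ hξ U).1.1 = U.1.1.2 :=
  rfl

theorem beamOperator_snd (a b α ξ : ℝ) (hξ : ξ ∈ Ioo (0 : ℝ) 1) (U : beamDomain a α ξ hξ) :
    (beamOperator a b α ξ hξ U).1.2 = -((a : ℂ) • fourthDeriv hξ U) - (b : ℂ) • U.1.1.2 :=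
  rfl

/-- `μ` is an eigenvalue of the unbounded operator `T`. -/
def IsEigenvalue (T : energySpace →ₗ.[ℂ] energySpace) (μ : ℂ) : Prop :=
  ∃ U : T.domain, U ≠ 0 ∧ T U = μ • (U : energySpace)

/-- The resolvent set of `T` in the energy space with norm `energyNorm a`: the `μ` for which
`μ - T : D(T) → 𝓗` is bijective with bounded inverse. -/
def resolventSetOf (a : ℝ) (T : energySpace →ₗ.[ℂ] energySpace) : Set ℂ :=
  {μ | Function.Bijective (fun U : T.domain => μ • (U : energySpace) - T U) ∧
    ∃ C : ℝ, ∀ U : T.domain, energyNorm a U ≤ C * energyNorm a (μ • (U : energySpace) - T U)}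

/-- The spectrum of `T` in the energy space with norm `energyNorm a`. -/
def spectrumOf (a : ℝ) (T : energySpace →ₗ.[ℂ] energySpace) : Set ℂ :=
  (resolventSetOf a T)ᶜ

/-! Everything rests on one quadratic identity. Pair the fourth-order equation with `u` and
integrate by parts on both sides of ξ: `u`, `u'` and `u''` match at ξ, so only the jump of `u'''`
survives (`InBeamDomain.energy_identity`). With Q = ‖u''‖², N = ‖u‖² and s = |u(ξ)|², an
eigenfunction satisfies a Q + α μ s + μ(μ+b) N = 0. The sharp Wirtinger inequality gives π⁴ N ≤ Q,
and s ≤ Q.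

For Re μ > -b/2 and α ≥ 0 the imaginary part of the identity forces μ to be real. For real μ the
real part is controlled by μ² + bμ + aπ⁴, which is at least (μ-κ)² for μ > κ, where κ is the claimed
bound. The damping term is at least -αbQ, so small α moves the bound by at most ε.

At α = 0 the same quadratic form gives the whole spectrum bound. Eliminating `v` from the resolvent
equation leaves a u'''' + μ(μ+b)u = g. With S the inverse of the Dirichlet second derivative, p =
u'''' solves (a + μ(μ+b)S²)p = g. Since S is symmetric with ‖S‖ ≤ π⁻², the form is coercive as soon
as a + μ(μ+b)θ ≠ 0 on [0, π⁻⁴], which holds for Re μ > κ (`mem_resolventSetOf_beamOperator`). The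
bound is attained: sin πx yields an eigenvalue with real part κ (`isEigenvalue_of_quadratic`). -/

/-! ### Primitives of complex integrable functions -/

/-- `F` is a primitive of the integrable function `f` on `[c, d]`. -/
structure IsPrimitive (c d : ℝ) (F f : ℝ → ℂ) : Prop where
  integrable : IntervalIntegrable f volume c d
  eq_add : ∀ x ∈ Icc c d, F x = F c + ∫ t in c..x, f t

/-- Each increment of ∫f is dominated by the increment of the real function ∫‖f‖, so absolute
continuity follows by squeezing. -/
theorem absolutelyContinuousOnInterval_integral {f : ℝ → ℂ} {c d : ℝ}
    (h : IntervalIntegrable f volume c d) :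
    AbsolutelyContinuousOnInterval (fun x => ∫ t in c..x, f t) c d := by
  have hN := h.norm.absolutelyContinuousOnInterval_intervalIntegral (c := c) left_mem_uIcc
  unfold AbsolutelyContinuousOnInterval at hN ⊢
  refine squeeze_zero' (Filter.Eventually.of_forall fun _ => Finset.sum_nonneg fun _ _ => dist_nonneg)
    ?_ hN
  rw [Filter.eventually_inf_principal]
  filter_upwards with E hE
  refine Finset.sum_le_sum fun i hi => ?_
  obtain ⟨h1, h2⟩ := hE.1 i hi
  have i1 := h.mono_set (uIcc_subset_uIcc_left h1)
  have i2 := h.mono_set (uIcc_subset_uIcc_left h2)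
  rw [dist_eq_norm, dist_eq_norm, intervalIntegral.integral_interval_sub_left i1 i2,
    intervalIntegral.integral_interval_sub_left i1.norm i2.norm, Real.norm_eq_abs]
  exact intervalIntegral.norm_integral_le_abs_integral_norm

/-- F - ∫f is absolutely continuous with zero derivative almost everywhere, hence constant. -/
theorem isPrimitive_of_ac {c d : ℝ} (hcd : c ≤ d) {F f : ℝ → ℂ}
    (hF : AbsolutelyContinuousOnInterval F c d) (hf : IntervalIntegrable f volume c d)
    (hd : ∀ᵐ x, x ∈ uIcc c d → HasDerivAt F (f x) x) : IsPrimitive c d F f where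
  integrable := hf
  eq_add := by
    have hac := hF.fun_sub (absolutelyContinuousOnInterval_integral hf)
    obtain ⟨C, hC⟩ := hac.const_of_ae_hasDerivAt_zero (by
      filter_upwards [hd, hf.ae_hasDerivAt_integral] with x h1 h2 hx
      simpa using (h1 hx).fun_sub (h2 hx c left_mem_uIcc))
    intro x hx
    have e1 := hC x (by rwa [uIcc_of_le hcd])
    have e2 := hC c left_mem_uIcc
    simp only [intervalIntegral.integral_same, sub_zero] at e1 e2
    rw [e2, ← e1]
    ring

namespace IsPrimitive

variable {c d : ℝ} {F f G g : ℝ → ℂ}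

theorem of_integral (hf : IntervalIntegrable f volume c d) (C : ℂ) :
    IsPrimitive c d (fun x => C + ∫ t in c..x, f t) f :=
  ⟨hf, fun x _ => by simp⟩

theorem ac (hcd : c ≤ d) (h : IsPrimitive c d F f) : AbsolutelyContinuousOnInterval F c d := by
  have h1 := absolutelyContinuousOnInterval_integral h.integrable
  unfold AbsolutelyContinuousOnInterval at h1 ⊢
  refine h1.congr' ?_
  rw [Filter.EventuallyEq, Filter.eventually_inf_principal]
  filter_upwards with E hE
  refine Finset.sum_congr rfl fun i hi => ?_
  obtain ⟨k1, k2⟩ := hE.1 i hi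
  rw [uIcc_of_le hcd] at k1 k2
  rw [h.eq_add _ k1, h.eq_add _ k2, dist_add_left]

theorem continuousOn (hcd : c ≤ d) (h : IsPrimitive c d F f) : ContinuousOn F (Icc c d) := by
  have := (h.ac hcd).continuousOn
  rwa [uIcc_of_le hcd] at this

theorem ae_hasDerivAt (hcd : c ≤ d) (h : IsPrimitive c d F f) :
    ∀ᵐ x, x ∈ uIcc c d → HasDerivAt F (f x) x := by
  have hc : ∀ᵐ x : ℝ, x ≠ c := by simp [ae_iff]
  have hd : ∀ᵐ x : ℝ, x ≠ d := by simp [ae_iff]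
  filter_upwards [h.integrable.ae_hasDerivAt_integral, hc, hd] with x h1 h2 h3 hx
  have hx' := hx
  rw [uIcc_of_le hcd] at hx'
  have hm : Icc c d ∈ nhds x :=
    Icc_mem_nhds (lt_of_le_of_ne hx'.1 (Ne.symm h2)) (lt_of_le_of_ne hx'.2 h3)
  refine ((h1 hx c left_mem_uIcc).const_add (F c)).congr_of_eventuallyEq ?_
  filter_upwards [hm] with y hy using h.eq_add y hy

theorem hasDerivAt (h : IsPrimitive c d F f) (hf : ContinuousOn f (Icc c d)) {x : ℝ}
    (hx : x ∈ Ioo c d) : HasDerivAt F (f x) x := by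
  have hm : Icc c d ∈ nhds x := Icc_mem_nhds hx.1 hx.2
  have h1 : HasDerivAt (fun y => ∫ t in c..y, f t) (f x) x := by
    refine intervalIntegral.integral_hasDerivAt_right
      (h.integrable.mono_set (uIcc_subset_uIcc_left ?_)) ?_ (hf.continuousAt hm)
    · rw [uIcc_of_le (hx.1.trans hx.2).le]; exact Ioo_subset_Icc_self hx
    · exact (hf.mono Ioo_subset_Icc_self).stronglyMeasurableAtFilter isOpen_Ioo x hx
  refine (h1.const_add (F c)).congr_of_eventuallyEq ?_
  filter_upwards [hm] with y hy using h.eq_add y hy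

/-- Combined with `integral_eq`, this is the integration by parts used throughout, with derivatives
that are merely integrable. -/
theorem mul (hcd : c ≤ d) (hF : IsPrimitive c d F f) (hG : IsPrimitive c d G g) :
    IsPrimitive c d (fun x => F x * G x) (fun x => f x * G x + F x * g x) := by
  refine isPrimitive_of_ac hcd ((hF.ac hcd).fun_smul (hG.ac hcd)) ?_ ?_
  · exact (hF.integrable.mul_continuousOn (hG.ac hcd).continuousOn).add
      (hG.integrable.continuousOn_mul (hF.ac hcd).continuousOn)
  · filter_upwards [hF.ae_hasDerivAt hcd, hG.ae_hasDerivAt hcd] with x h1 h2 hx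
    exact (h1 hx).mul (h2 hx)

theorem integral_eq (hcd : c ≤ d) (h : IsPrimitive c d F f) : ∫ x in c..d, f x = F d - F c := by
  rw [h.eq_add d (right_mem_Icc.2 hcd)]
  ring

theorem conj (h : IsPrimitive c d F f) :
    IsPrimitive c d (fun x => starRingEnd ℂ (F x)) (fun x => starRingEnd ℂ (f x)) where
  integrable := ⟨(Complex.conjCLE : ℂ →L[ℝ] ℂ).integrable_comp h.integrable.1,
    (Complex.conjCLE : ℂ →L[ℝ] ℂ).integrable_comp h.integrable.2⟩
  eq_add := by
    intro x hx
    rw [h.eq_add x hx, map_add, intervalIntegral.intervalIntegral_conj]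

theorem mono (hcd : c ≤ d) (h : IsPrimitive c d F f) {c' d' : ℝ} (h1 : c ≤ c') (h2 : c' ≤ d')
    (h3 : d' ≤ d) : IsPrimitive c' d' F f where
  integrable := h.integrable.mono_set (by
    rw [uIcc_of_le h2, uIcc_of_le hcd]; exact Icc_subset_Icc h1 h3)
  eq_add := by
    intro x hx
    have hi : ∀ y ∈ Icc c d, IntervalIntegrable f volume c y := fun y hy =>
      h.integrable.mono_set (uIcc_subset_uIcc_left (by rwa [uIcc_of_le hcd]))
    have hc' : c' ∈ Icc c d := ⟨h1, h2.trans h3⟩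
    have hx' : x ∈ Icc c d := ⟨h1.trans hx.1, hx.2.trans h3⟩
    rw [h.eq_add x hx', h.eq_add c' hc', add_assoc,
      intervalIntegral.integral_add_adjacent_intervals (hi c' hc')
        ((hi c' hc').symm.trans (hi x hx'))]

theorem congr_ae (hcd : c ≤ d) (h : IsPrimitive c d F f) {f' : ℝ → ℂ}
    (he : f =ᵐ[volume.restrict (Ioo c d)] f') : IsPrimitive c d F f' where
  integrable := by
    rw [intervalIntegrable_iff_integrableOn_Ioo_of_le hcd]
    exact ((intervalIntegrable_iff_integrableOn_Ioo_of_le hcd).1 h.integrable).congr_fun_ae he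
  eq_add := by
    intro x hx
    rw [h.eq_add x hx, intervalIntegral.integral_of_le hx.1, intervalIntegral.integral_of_le hx.1,
      integral_Ioc_eq_integral_Ioo, integral_Ioc_eq_integral_Ioo]
    congr 1
    exact integral_congr_ae (ae_restrict_of_ae_restrict_of_subset (Ioo_subset_Ioo_right hx.2) he)

theorem of_hasDerivAt (hd : ∀ x, HasDerivAt F (f x) x) (hf : Continuous f) :
    IsPrimitive c d F f where
  integrable := hf.intervalIntegrable _ _
  eq_add := by
    intro x _
    rw [intervalIntegral.integral_eq_sub_of_hasDerivAt (fun y _ => hd y)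
      (hf.intervalIntegrable _ _)]
    ring

end IsPrimitive

/-! ### Calculus of weak derivatives and the du Bois-Reymond lemma -/

theorem tsupport_iteratedDeriv_subset (k : ℕ) (φ : ℝ → ℝ) :
    tsupport (iteratedDeriv k φ) ⊆ tsupport φ := by
  refine closure_minimal ?_ (isClosed_tsupport φ)
  intro x hx
  have : x ∈ Function.support (iteratedFDeriv ℝ k φ) := by
    intro h0
    apply hx
    rw [iteratedDeriv_eq_iteratedFDeriv, h0]
    simp
  exact support_iteratedFDeriv_subset k this

theorem contDiff_iteratedDeriv {φ : ℝ → ℝ} (h : ContDiff ℝ ∞ φ) (k : ℕ) :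
    ContDiff ℝ ∞ (iteratedDeriv k φ) := by
  rw [iteratedDeriv_eq_iterate]
  exact h.iterate_deriv k

theorem iteratedDeriv_iteratedDeriv (j k : ℕ) (φ : ℝ → ℝ) :
    iteratedDeriv j (iteratedDeriv k φ) = iteratedDeriv (j + k) φ := by
  simp only [iteratedDeriv_eq_iterate, Function.iterate_add_apply]

theorem setIntegral_test_smul_mono {Ω Ω' : Set ℝ} (hΩ : MeasurableSet Ω) (hs : Ω' ⊆ Ω)
    {f : ℝ → ℝ} (hf : tsupport f ⊆ Ω') (u : ℝ → ℂ) :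
    ∫ x in Ω, f x • u x = ∫ x in Ω', f x • u x :=
  setIntegral_eq_of_subset_of_forall_sdiff_eq_zero hΩ hs fun x hx => by
    rw [image_eq_zero_of_notMem_tsupport (fun h => hx.2 (hf h)), zero_smul]

namespace HasWeakDeriv

variable {Ω : Set ℝ} {j k : ℕ} {u w w' : ℝ → ℂ}

theorem mono (hΩ : MeasurableSet Ω) (h : HasWeakDeriv Ω k u w) {Ω' : Set ℝ} (hs : Ω' ⊆ Ω) :
    HasWeakDeriv Ω' k u w where
  locInt := h.locInt.mono_set hs
  locInt' := h.locInt'.mono_set hs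
  integral_eq := by
    intro φ h1 h2 h3
    rw [← setIntegral_test_smul_mono hΩ hs ((tsupport_iteratedDeriv_subset k φ).trans h3),
      ← setIntegral_test_smul_mono hΩ hs h3]
    exact h.integral_eq φ h1 h2 (h3.trans hs)

theorem self (hu : LocallyIntegrableOn u Ω) : HasWeakDeriv Ω 0 u u :=
  ⟨hu, hu, by intro φ _ _ _; simp⟩

theorem comp (h : HasWeakDeriv Ω j u w) (h' : HasWeakDeriv Ω k w w') :
    HasWeakDeriv Ω (j + k) u w' where
  locInt := h.locInt
  locInt' := h'.locInt'
  integral_eq := by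
    intro φ h1 h2 h3
    have hts := tsupport_iteratedDeriv_subset k φ
    rw [← iteratedDeriv_iteratedDeriv, h.integral_eq _ (contDiff_iteratedDeriv h1 k)
      (h2.of_isClosed_subset (isClosed_tsupport _) hts) (hts.trans h3),
      h'.integral_eq φ h1 h2 h3]
    ring

/-- Testing `u` against φ^(j+k) can be evaluated through `w` or through `w'`; cancelling (-1)^j
compares them. This reduces regularity questions of any order to first order. -/
theorem of_comp (h : HasWeakDeriv Ω j u w) (h' : HasWeakDeriv Ω (j + k) u w') :
    HasWeakDeriv Ω k w w' where
  locInt := h.locInt'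
  locInt' := h'.locInt'
  integral_eq := by
    intro φ h1 h2 h3
    have hts := tsupport_iteratedDeriv_subset k φ
    have e := h.integral_eq _ (contDiff_iteratedDeriv h1 k)
      (h2.of_isClosed_subset (isClosed_tsupport _) hts) (hts.trans h3)
    rw [iteratedDeriv_iteratedDeriv, h'.integral_eq φ h1 h2 h3, pow_add, mul_assoc] at e
    exact (mul_left_cancel₀ (pow_ne_zero j (by norm_num)) e).symm

theorem eq_self (hΩ : IsOpen Ω) (h : HasWeakDeriv Ω 0 u w) : u =ᵐ[volume.restrict Ω] w := by
  rw [Filter.EventuallyEq, ae_restrict_iff' hΩ.measurableSet]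
  exact (self h.locInt).ae_unique hΩ h

end HasWeakDeriv

theorem IsPrimitive.hasWeakDeriv {c d : ℝ} (hcd : c ≤ d) {F f : ℝ → ℂ}
    (h : IsPrimitive c d F f) : HasWeakDeriv (Ioo c d) 1 F f where
  locInt := ((h.continuousOn hcd).mono Ioo_subset_Icc_self).locallyIntegrableOn measurableSet_Ioo
  locInt' :=
    ((intervalIntegrable_iff_integrableOn_Ioo_of_le hcd).1 h.integrable).locallyIntegrableOn
  integral_eq := by
    intro φ h1 h2 h3
    have hz : ∀ x, x ∉ Ioo c d → φ x = 0 := fun x hx =>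
      image_eq_zero_of_notMem_tsupport fun h => hx (h3 h)
    have hφ : IsPrimitive c d (fun x => (φ x : ℂ)) (fun x => ((deriv φ x : ℝ) : ℂ)) :=
      IsPrimitive.of_hasDerivAt
        (fun x => ((h1.differentiable (by simp)) x).hasDerivAt.ofReal_comp)
        (Complex.continuous_ofReal.comp (h1.continuous_deriv (by simp)))
    have hp := (hφ.mul hcd h).integral_eq hcd
    rw [hz c (by simp), hz d (by simp), intervalIntegral.integral_add
      (hφ.integrable.mul_continuousOn (by rw [uIcc_of_le hcd]; exact h.continuousOn hcd))
      (h.integrable.continuousOn_mul (by rw [uIcc_of_le hcd]; exact hφ.continuousOn hcd)),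
      intervalIntegral.integral_of_le hcd, intervalIntegral.integral_of_le hcd,
      integral_Ioc_eq_integral_Ioo, integral_Ioc_eq_integral_Ioo] at hp
    simp only [iteratedDeriv_one, Complex.real_smul]
    rw [Complex.ofReal_zero] at hp
    linear_combination hp

/-- The primitive ∫_c^x ψ vanishes to the left of the support of ψ and, because ψ has mean zero,
also to the right of it. -/
theorem exists_testFunction_primitive {c d : ℝ} {ψ : ℝ → ℝ} (h1 : ContDiff ℝ ∞ ψ)
    (h2 : HasCompactSupport ψ) (h3 : tsupport ψ ⊆ Ioo c d) (h4 : ∫ x in c..d, ψ x = 0) :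
    ∃ Ψ : ℝ → ℝ, ContDiff ℝ ∞ Ψ ∧ HasCompactSupport Ψ ∧ tsupport Ψ ⊆ Ioo c d ∧
      deriv Ψ = ψ := by
  rcases (tsupport ψ).eq_empty_or_nonempty with he | hne
  · rw [tsupport_eq_empty_iff] at he
    subst he
    exact ⟨0, contDiff_const, HasCompactSupport.zero, by simp [tsupport], by ext; simp⟩
  have hz : ∀ x, x ∉ tsupport ψ → ψ x = 0 := fun x hx => image_eq_zero_of_notMem_tsupport hx
  obtain ⟨p, hp, hpmin⟩ := h2.isCompact.exists_isLeast hne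
  obtain ⟨q, hq, hqmax⟩ := h2.isCompact.exists_isGreatest hne
  have hi : ∀ x y, IntervalIntegrable ψ volume x y := fun x y => h1.continuous.intervalIntegrable _ _
  have hder : ∀ x, HasDerivAt (fun y => ∫ t in c..y, ψ t) (ψ x) x := fun x =>
    h1.continuous.integral_hasStrictDerivAt c x |>.hasDerivAt
  have hsub : Function.support (fun y => ∫ t in c..y, ψ t) ⊆ Icc p q := by
    intro x hx
    by_contra hn
    apply hx
    have hzero : ∀ y z, (∀ t ∈ uIcc y z, t ∉ Icc p q) → ∫ t in y..z, ψ t = 0 := by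
      intro y z hyz
      rw [intervalIntegral.integral_congr (g := fun _ => 0) fun t ht =>
        hz t fun hm => hyz t ht ⟨hpmin hm, hqmax hm⟩]
      simp
    rcases lt_or_ge x p with hlt | hge
    · refine hzero c x fun t ht hm => ?_
      have : t < p := lt_of_le_of_lt ht.2 (max_lt (h3 hp).1 hlt)
      exact absurd hm.1 (not_le.2 this)
    · have hgt : q < x := by
        by_contra hle
        exact hn ⟨hge, not_lt.1 hle⟩
      -- To the right of q the integral over [x, d] is zero, so the integral over [c, x] equals the
      -- total mean, which is zero.
      have e := intervalIntegral.integral_add_adjacent_intervals (hi c x) (hi x d)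
      rw [hzero x d, h4, add_zero] at e
      · exact e
      · intro t ht hm
        have : q < t := lt_of_lt_of_le (lt_min hgt (h3 hq).2) ht.1
        exact absurd hm.2 (not_le.2 this)
  have hts : tsupport (fun y => ∫ t in c..y, ψ t) ⊆ Icc p q := closure_minimal hsub isClosed_Icc
  have hdv : deriv (fun y => ∫ t in c..y, ψ t) = ψ := funext fun x => (hder x).deriv
  refine ⟨_, ?_, isCompact_Icc.of_isClosed_subset (isClosed_tsupport _) hts, hts.trans ?_, hdv⟩
  · rw [contDiff_infty_iff_deriv, hdv]
    exact ⟨fun x => (hder x).differentiableAt, h1⟩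
  · exact fun x hx => ⟨lt_of_lt_of_le (h3 hp).1 hx.1, lt_of_le_of_lt hx.2 (h3 hq).2⟩

/-- Fix a bump η of integral 1. For any test function φ, φ - (∫φ)η has mean zero, so it is the
derivative of a test function and u integrates to zero against it. Hence ∫φu = ∫φC with C = ∫ηu. -/
theorem HasWeakDeriv.ae_const {c d : ℝ} (hcd : c < d) {u : ℝ → ℂ}
    (h : HasWeakDeriv (Ioo c d) 1 u (fun _ => 0)) :
    ∃ C : ℂ, u =ᵐ[volume.restrict (Ioo c d)] fun _ => C := by
  -- The outer radius (d - c)/4 about the midpoint keeps the closed support inside the open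
  -- interval.
  let φ₀ : ContDiffBump ((c + d) / 2) :=
    ⟨(d - c) / 8, (d - c) / 4, by linarith, by linarith⟩
  set η : ℝ → ℝ := φ₀.normed volume
  have hη1 : ContDiff ℝ ∞ η := φ₀.contDiff_normed
  have hη2 : HasCompactSupport η := φ₀.hasCompactSupport_normed
  have hη3 : tsupport η ⊆ Ioo c d := by
    rw [φ₀.tsupport_normed_eq, Real.closedBall_eq_Icc]
    intro x hx
    have e : φ₀.rOut = (d - c) / 4 := rfl
    rw [e] at hx
    exact ⟨by linarith [hx.1], by linarith [hx.2]⟩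
  have hint : ∀ ψ : ℝ → ℝ, tsupport ψ ⊆ Ioo c d → ∫ x in c..d, ψ x = ∫ x, ψ x := by
    intro ψ hψ
    rw [intervalIntegral.integral_of_le hcd.le, integral_Ioc_eq_integral_Ioo]
    exact setIntegral_eq_integral_of_forall_compl_eq_zero fun x hx =>
      image_eq_zero_of_notMem_tsupport fun hm => hx (hψ hm)
  have hη4 : ∫ x, η x = 1 := φ₀.integral_normed
  refine ⟨∫ x in Ioo c d, η x • u x, ?_⟩
  set C := ∫ x in Ioo c d, η x • u x
  have hC : LocallyIntegrableOn (fun _ : ℝ => C) (Ioo c d) :=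
    continuousOn_const.locallyIntegrableOn measurableSet_Ioo
  have key := isOpen_Ioo.ae_eq_zero_of_integral_contDiff_smul_eq_zero (h.locInt.sub hC) (by
    intro φ k1 k2 k3
    set m := ∫ x, φ x
    have s3 : tsupport (fun x => φ x - m * η x) ⊆ Ioo c d := by
      refine (tsupport_sub φ (fun x => m * η x)).trans (union_subset k3 ?_)
      exact (tsupport_mul_subset_right (f := fun _ => m)).trans hη3
    have s2 : HasCompactSupport (fun x => φ x - m * η x) := k2.sub hη2.mul_left
    obtain ⟨Ψ, p1, p2, p3, p4⟩ := exists_testFunction_primitive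
      (k1.sub (contDiff_const.mul hη1)) s2 s3 (by
        rw [hint _ s3, integral_sub (k1.continuous.integrable_of_hasCompactSupport k2)
          ((hη1.continuous.integrable_of_hasCompactSupport hη2).const_mul m),
          integral_const_mul, hη4]
        simp [m])
    have e := h.integral_eq Ψ p1 p2 p3
    rw [iteratedDeriv_one, p4] at e
    have i1 := integrableOn_test_smul isOpen_Ioo h.locInt k1.continuous k2 k3
    have i2 := integrableOn_test_smul isOpen_Ioo h.locInt hη1.continuous hη2 hη3
    have i3 := integrableOn_test_smul isOpen_Ioo hC k1.continuous k2 k3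
    simp only [sub_smul, mul_smul] at e
    have i4 : IntegrableOn (fun x => m • η x • u x) (Ioo c d) := i2.smul m
    rw [integral_sub i1 i4, integral_smul] at e
    rw [← setIntegral_eq_integral_of_forall_compl_eq_zero (s := Ioo c d)]
    · simp only [Pi.sub_apply, smul_sub]
      rw [integral_sub i1 i3, integral_smul_const,
        setIntegral_eq_integral_of_forall_compl_eq_zero (f := φ)]
      · simp only [smul_zero, integral_zero, mul_zero] at e
        exact e
      · exact fun x hx => image_eq_zero_of_notMem_tsupport fun hm => hx (k3 hm)
    · intro x hx
      rw [image_eq_zero_of_notMem_tsupport (fun hx' => hx (k3 hx')), zero_smul])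
  rw [Filter.EventuallyEq, ae_restrict_iff' measurableSet_Ioo]
  filter_upwards [key] with x hx hxΩ
  exact sub_eq_zero.mp (hx hxΩ)

/-- Subtracting ∫w from u leaves a function with zero weak derivative, hence a constant. -/
theorem HasWeakDeriv.exists_isPrimitive {c d : ℝ} (hcd : c < d) {u w : ℝ → ℂ}
    (h : HasWeakDeriv (Ioo c d) 1 u w) (hw : IntegrableOn w (Ioo c d)) :
    ∃ F : ℝ → ℂ, IsPrimitive c d F w ∧ u =ᵐ[volume.restrict (Ioo c d)] F := by
  have hw' : IntervalIntegrable w volume c d :=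
    (intervalIntegrable_iff_integrableOn_Ioo_of_le hcd.le).2 hw
  have h0 := ((IsPrimitive.of_integral hw' 0).hasWeakDeriv hcd.le).smul (-1)
  obtain ⟨C, hC⟩ := ((h.add isOpen_Ioo h0).congr (Filter.EventuallyEq.refl _ _)
    (w' := fun _ => 0) (by filter_upwards with x; ring)).ae_const hcd
  refine ⟨_, IsPrimitive.of_integral hw' C, ?_⟩
  filter_upwards [hC] with x hx
  linear_combination hx

theorem eqOn_of_ae_eq {c d : ℝ} (hcd : c < d) {f g : ℝ → ℂ} (hf : ContinuousOn f (Icc c d))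
    (hg : ContinuousOn g (Icc c d)) (h : f =ᵐ[volume.restrict (Ioo c d)] g) :
    EqOn f g (Icc c d) := by
  have h1 : EqOn f g (Ioo c d) := Measure.eqOn_open_of_ae_eq h isOpen_Ioo
    (hf.mono Ioo_subset_Icc_self) (hg.mono Ioo_subset_Icc_self)
  exact h1.of_subset_closure hf hg Ioo_subset_Icc_self (by rw [closure_Ioo hcd.ne])

/-! ### L² integrals, the sharp Wirtinger inequality and a pointwise bound -/

theorem integral_normSq_eq (F : ℝ → ℂ) (c d : ℝ) :
    ∫ x in c..d, starRingEnd ℂ (F x) * F x = ((∫ x in c..d, ‖F x‖ ^ 2 : ℝ) : ℂ) := by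
  rw [← intervalIntegral.integral_ofReal]
  refine intervalIntegral.integral_congr fun x _ => ?_
  rw [mul_comm, Complex.mul_conj, Complex.normSq_eq_norm_sq]

theorem L2I.inner_eq {u v : L2I} {F G : ℝ → ℂ} (hu : u =ᵐ[volume.restrict (Ioo 0 1)] F)
    (hv : v =ᵐ[volume.restrict (Ioo 0 1)] G) :
    inner ℂ u v = ∫ x in (0 : ℝ)..1, starRingEnd ℂ (F x) * G x := by
  rw [L2.inner_def, intervalIntegral.integral_of_le zero_le_one, integral_Ioc_eq_integral_Ioo]
  refine integral_congr_ae ?_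
  filter_upwards [hu, hv] with x h1 h2
  rw [h1, h2, RCLike.inner_apply, mul_comm]

theorem L2I.norm_sq_eq {u : L2I} {F : ℝ → ℂ} (hu : u =ᵐ[volume.restrict (Ioo 0 1)] F) :
    ‖u‖ ^ 2 = ∫ x in (0 : ℝ)..1, ‖F x‖ ^ 2 := by
  rw [← inner_self_eq_norm_sq (𝕜 := ℂ), L2I.inner_eq hu hu, integral_normSq_eq]
  exact Complex.ofReal_re _

theorem L2I.integrableOn (u : L2I) : IntegrableOn u (Ioo 0 1) :=
  (Lp.memLp u).integrable (by norm_num)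

/-- Jordan's inequality on [0, 1/2], reflected by x ↦ 1 - x. It controls cot πx near both endpoints.
-/
theorem two_mul_mul_le_sin {x : ℝ} (h0 : 0 ≤ x) (h1 : x ≤ 1) :
    2 * (x * (1 - x)) ≤ Real.sin (Real.pi * x) := by
  have key : ∀ y : ℝ, 0 ≤ y → y ≤ 1 / 2 → 2 * y ≤ Real.sin (Real.pi * y) := by
    intro y hy hy'
    have := Real.mul_le_sin (x := Real.pi * y) (by positivity)
      (by nlinarith [Real.pi_pos])
    have e : 2 / Real.pi * (Real.pi * y) = 2 * y := by field_simp
    linarith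
  rcases le_total x (1 / 2) with h | h
  · nlinarith [key x h0 h]
  · have := key (1 - x) (by linarith) (by linarith)
    rw [show Real.pi * (1 - x) = Real.pi - Real.pi * x by ring, Real.sin_pi_sub] at this
    nlinarith

/-- Jacobi's trick: c = π cot πx satisfies c' = -π² - c², so ‖f - cF‖² = ‖f‖² - π²‖F‖² - (c‖F‖²)'.
Integrate; the boundary terms vanish because F is Lipschitz and zero at both ends, which beats the
simple pole of c. -/
theorem wirtinger {F f : ℝ → ℂ} (h : IsPrimitive 0 1 F f) (hf : ContinuousOn f (Icc 0 1))
    (h0 : F 0 = 0) (h1 : F 1 = 0) :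
    Real.pi ^ 2 * ∫ x in (0 : ℝ)..1, ‖F x‖ ^ 2 ≤ ∫ x in (0 : ℝ)..1, ‖f x‖ ^ 2 := by
  have hF : ContinuousOn F (Icc 0 1) := h.continuousOn zero_le_one
  obtain ⟨M, hM⟩ := isCompact_Icc.exists_bound_of_continuousOn hf
  have hM0 : 0 ≤ M := (norm_nonneg _).trans (hM 0 (by simp))
  have hlip : ∀ x y : ℝ, 0 ≤ x → x ≤ y → y ≤ 1 → ‖F y - F x‖ ≤ M * (y - x) := by
    intro x y hx hxy hy
    rw [← (h.mono zero_le_one hx hxy hy).integral_eq hxy]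
    refine (intervalIntegral.norm_integral_le_of_norm_le_const fun t ht => ?_).trans
      (by rw [abs_of_nonneg (by linarith)])
    rw [uIoc_of_le hxy] at ht
    exact hM t ⟨hx.trans ht.1.le, ht.2.trans hy⟩
  -- Use the Lipschitz bound from the nearer endpoint; the factor 2 absorbs the other of x and 1 -
  -- x, which is at least 1/2.
  have hFb : ∀ x ∈ Ioo (0 : ℝ) 1, ‖F x‖ ≤ 2 * M * (x * (1 - x)) := by
    intro x hx
    have e1 := hlip 0 x le_rfl hx.1.le hx.2.le
    have e2 := hlip x 1 hx.1.le hx.2.le le_rfl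
    rw [h0, sub_zero] at e1
    rw [h1, zero_sub, norm_neg] at e2
    have hx1 := hx.1
    have hx2 := hx.2
    rcases le_total x (1 / 2) with hle | hle
    · have : M * (x - 0) ≤ 2 * M * (x * (1 - x)) := by
        have := mul_nonneg (mul_nonneg hM0 hx1.le) (by linarith : 0 ≤ 1 - 2 * x)
        linarith
      linarith
    · have : M * (1 - x) ≤ 2 * M * (x * (1 - x)) := by
        have := mul_nonneg (mul_nonneg hM0 (by linarith : 0 ≤ 1 - x)) (by linarith : 0 ≤ 2 * x - 1)
        linarith
      linarith
  let H : ℝ → ℝ := fun x =>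
    Real.pi * (Real.cos (Real.pi * x) / Real.sin (Real.pi * x)) * ‖F x‖ ^ 2
  have hsin : ∀ x ∈ Ioo (0 : ℝ) 1, 0 < Real.sin (Real.pi * x) := by
    intro x hx
    refine lt_of_lt_of_le ?_ (two_mul_mul_le_sin hx.1.le hx.2.le)
    have := mul_pos hx.1 (sub_pos.2 hx.2)
    linarith
  have hHb : ∀ x ∈ Ioo (0 : ℝ) 1, ‖H x‖ ≤ 2 * Real.pi * M ^ 2 * (x * (1 - x)) := by
    intro x hx
    have hs := hsin x hx
    have hs2 := two_mul_mul_le_sin hx.1.le hx.2.le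
    have ht : 0 < x * (1 - x) := mul_pos hx.1 (sub_pos.2 hx.2)
    have e : ‖H x‖ = Real.pi * (|Real.cos (Real.pi * x)| / Real.sin (Real.pi * x)) * ‖F x‖ ^ 2 := by
      simp only [H, norm_mul, norm_div, Real.norm_eq_abs, abs_of_pos hs, abs_of_pos Real.pi_pos,
        norm_pow, abs_norm]
    rw [e]
    have c1 : |Real.cos (Real.pi * x)| / Real.sin (Real.pi * x) ≤ 1 / (2 * (x * (1 - x))) :=
      div_le_div₀ zero_le_one (Real.abs_cos_le_one _) (by linarith) hs2
    have c2 : ‖F x‖ ^ 2 ≤ (2 * M * (x * (1 - x))) ^ 2 :=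
      pow_le_pow_left₀ (norm_nonneg _) (hFb x hx) 2
    calc _ ≤ Real.pi * (1 / (2 * (x * (1 - x)))) * (2 * M * (x * (1 - x))) ^ 2 := by
          gcongr
      _ = _ := by field_simp
  let k : ℝ → ℝ := fun x => ‖f x‖ ^ 2 - Real.pi ^ 2 * ‖F x‖ ^ 2
  have hk : ContinuousOn k (Icc 0 1) :=
    (hf.norm.pow 2).sub (continuousOn_const.mul (hF.norm.pow 2))
  have hki : IntervalIntegrable k volume 0 1 := by
    apply ContinuousOn.intervalIntegrable
    rwa [uIcc_of_le zero_le_one]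
  have hder : ∀ x ∈ Ioo (0 : ℝ) 1, HasDerivAt (fun x => (∫ t in (0 : ℝ)..x, k t) - H x)
      (‖f x - (Real.pi * (Real.cos (Real.pi * x) / Real.sin (Real.pi * x))) • F x‖ ^ 2) x := by
    intro x hx
    have hs := (hsin x hx).ne'
    have d1 : HasDerivAt (fun y => ∫ t in (0 : ℝ)..y, k t) (k x) x := by
      refine intervalIntegral.integral_hasDerivAt_right
        (hki.mono_set (uIcc_subset_uIcc_left ?_)) ?_ (hk.continuousAt (Icc_mem_nhds hx.1 hx.2))
      · rw [uIcc_of_le zero_le_one]; exact Ioo_subset_Icc_self hx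
      · exact (hk.mono Ioo_subset_Icc_self).stronglyMeasurableAtFilter isOpen_Ioo x hx
    have d2 : HasDerivAt (fun y => ‖F y‖ ^ 2) _ x := (h.hasDerivAt hf hx).norm_sq
    have d0 : HasDerivAt (fun y : ℝ => Real.pi * y) Real.pi x := by
      simpa using (hasDerivAt_id x).const_mul Real.pi
    have d3 := ((d0.cos.div d0.sin hs).const_mul Real.pi).mul d2
    refine (d1.sub d3).congr_deriv ?_
    rw [norm_sub_sq_real, norm_smul, real_inner_smul_right, real_inner_comm (F x)]
    simp only [k, Real.norm_eq_abs, mul_pow, sq_abs, Pi.div_apply]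
    field_simp
    ring
  -- K has derivative ‖f - cF‖² ≥ 0 on the open interval and tends to 0 at 0 and to ∫k at 1. Since H
  -- is not controlled at the endpoints themselves, the two limits are compared through K(1/2).
  set K : ℝ → ℝ := fun x => (∫ t in (0 : ℝ)..x, k t) - H x
  have hmono : MonotoneOn K (Ioo 0 1) := by
    refine monotoneOn_of_deriv_nonneg (convex_Ioo 0 1)
      (fun x hx => (hder x hx).continuousAt.continuousWithinAt)
      (fun x hx => ?_) (fun x hx => ?_) <;> rw [interior_Ioo] at hx
    · exact (hder x hx).differentiableAt.differentiableWithinAt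
    · rw [(hder x hx).deriv]; positivity
  have hprim : ContinuousOn (fun x => ∫ t in (0 : ℝ)..x, k t) (Icc 0 1) :=
    intervalIntegral.continuousOn_primitive_interval (by
      rw [uIcc_of_le zero_le_one]
      exact hk.integrableOn_compact isCompact_Icc) |>.mono (by rw [uIcc_of_le zero_le_one])
  have hlim : ∀ p ∈ Icc (0 : ℝ) 1, p * (1 - p) = 0 →
      Filter.Tendsto K (nhdsWithin p (Ioo 0 1)) (nhds (∫ t in (0 : ℝ)..p, k t)) := by
    intro p hp hp0
    have t1 := (hprim p hp).mono_left (nhdsWithin_mono p Ioo_subset_Icc_self)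
    have t2 : Filter.Tendsto H (nhdsWithin p (Ioo 0 1)) (nhds 0) := by
      have hc : Continuous fun x : ℝ => 2 * Real.pi * M ^ 2 * (x * (1 - x)) := by fun_prop
      have hc' := (hc.tendsto p).mono_left (nhdsWithin_le_nhds (s := Ioo 0 1))
      rw [hp0, mul_zero] at hc'
      refine squeeze_zero_norm' ?_ hc'
      filter_upwards [self_mem_nhdsWithin] with x hx using hHb x hx
    simpa using t1.sub t2
  have hhalf : (1 / 2 : ℝ) ∈ Ioo (0 : ℝ) 1 := by constructor <;> norm_num
  have l0 := hlim 0 (by simp) (by simp)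
  have l1 := hlim 1 (by simp) (by simp)
  rw [intervalIntegral.integral_same] at l0
  have n0 : (nhdsWithin (0 : ℝ) (Ioo 0 1)).NeBot := left_nhdsWithin_Ioo_neBot zero_lt_one
  have n1 : (nhdsWithin (1 : ℝ) (Ioo 0 1)).NeBot := right_nhdsWithin_Ioo_neBot zero_lt_one
  have b0 : 0 ≤ K (1 / 2) := le_of_tendsto l0 (by
    filter_upwards [self_mem_nhdsWithin, nhdsWithin_le_nhds (Iio_mem_nhds hhalf.1)] with x hx hx'
    exact hmono hx hhalf (le_of_lt hx'))
  have b1 : K (1 / 2) ≤ ∫ t in (0 : ℝ)..1, k t := ge_of_tendsto l1 (by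
    filter_upwards [self_mem_nhdsWithin, nhdsWithin_le_nhds (Ioi_mem_nhds hhalf.2)] with x hx hx'
    exact hmono hhalf hx (le_of_lt hx'))
  have e : ∫ t in (0 : ℝ)..1, k t
      = (∫ x in (0 : ℝ)..1, ‖f x‖ ^ 2) - Real.pi ^ 2 * ∫ x in (0 : ℝ)..1, ‖F x‖ ^ 2 := by
    rw [intervalIntegral.integral_sub, intervalIntegral.integral_const_mul]
    · exact (by rw [uIcc_of_le zero_le_one]; exact hf.norm.pow 2 :
        ContinuousOn _ (uIcc (0 : ℝ) 1)).intervalIntegrable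
    · exact (by rw [uIcc_of_le zero_le_one]; exact continuousOn_const.mul (hF.norm.pow 2) :
        ContinuousOn _ (uIcc (0 : ℝ) 1)).intervalIntegrable
  linarith

/-- ‖F(x)‖ ≤ ∫‖f‖ = m, and m² ≤ ∫‖f‖² follows by expanding ∫(‖f‖ - m)² ≥ 0. -/
theorem sq_norm_le_integral_sq {F f : ℝ → ℂ} (h : IsPrimitive 0 1 F f)
    (hf : ContinuousOn f (Icc 0 1)) (h0 : F 0 = 0) {x : ℝ} (hx : x ∈ Icc (0 : ℝ) 1) :
    ‖F x‖ ^ 2 ≤ ∫ t in (0 : ℝ)..1, ‖f t‖ ^ 2 := by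
  have hc : ∀ {g : ℝ → ℝ}, ContinuousOn g (Icc 0 1) → IntervalIntegrable g volume 0 1 := by
    intro g hg
    apply ContinuousOn.intervalIntegrable
    rwa [uIcc_of_le zero_le_one]
  set m := ∫ t in (0 : ℝ)..1, ‖f t‖ with hm
  have i1 := hc hf.norm
  have i2 : IntervalIntegrable (fun t => ‖f t‖ ^ 2) volume 0 1 := hc (hf.norm.pow 2)
  have e1 : ‖F x‖ ≤ m := by
    rw [h.eq_add x hx, h0, zero_add]
    refine (intervalIntegral.norm_integral_le_integral_norm hx.1).trans ?_
    exact intervalIntegral.integral_mono_interval le_rfl hx.1 hx.2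
      (Filter.Eventually.of_forall fun t => norm_nonneg _) i1
  have e2 : 0 ≤ ∫ t in (0 : ℝ)..1, (‖f t‖ - m) ^ 2 :=
    intervalIntegral.integral_nonneg zero_le_one fun t _ => sq_nonneg _
  have e3 : ∫ t in (0 : ℝ)..1, (‖f t‖ - m) ^ 2
      = (∫ t in (0 : ℝ)..1, ‖f t‖ ^ 2) - 2 * m * m + m ^ 2 := by
    rw [intervalIntegral.integral_congr (g := fun t => ‖f t‖ ^ 2 - 2 * m * ‖f t‖ + m ^ 2)
      (fun t _ => by simp only; ring), intervalIntegral.integral_add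
      (i2.sub (i1.const_mul _)) intervalIntegrable_const, intervalIntegral.integral_sub i2
      (i1.const_mul _), intervalIntegral.integral_const_mul, ← hm]
    simp
  have := pow_le_pow_left₀ (norm_nonneg _) e1 2
  linarith

/-! ### Continuous representatives and traces -/

theorem HasWeakDeriv.exists_isPrimitive_succ {c d : ℝ} (hcd : c < d) {j : ℕ} {u w w' : ℝ → ℂ}
    (h : HasWeakDeriv (Ioo c d) j u w) (h' : HasWeakDeriv (Ioo c d) (j + 1) u w')
    (hi : IntegrableOn w' (Ioo c d)) :
    ∃ F : ℝ → ℂ, IsPrimitive c d F w' ∧ w =ᵐ[volume.restrict (Ioo c d)] F :=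
  (h.of_comp h').exists_isPrimitive hcd hi

theorem MemHk.exists_integrableOn {c d : ℝ} {k j : ℕ} {u : ℝ → ℂ} (h : MemHk (Ioo c d) k u)
    (hj : j ≤ k) : ∃ w : ℝ → ℂ, IntegrableOn w (Ioo c d) ∧ HasWeakDeriv (Ioo c d) j u w := by
  obtain ⟨w, hw, hd⟩ := h j hj
  exact ⟨w, hw.integrable (by norm_num), hd⟩

theorem HasWeakDeriv.congr_right {Ω : Set ℝ} {k : ℕ} {u w w' : ℝ → ℂ} (h : HasWeakDeriv Ω k u w)
    (hw : w =ᵐ[volume.restrict Ω] w') : HasWeakDeriv Ω k u w' :=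
  h.congr (Filter.EventuallyEq.refl _ _) hw

/-- A function in `H^{k+2}` whose weak derivative of order `k + 2` is `w` has weak derivatives of
order `k` and `k + 1` that are iterated primitives of `w`. -/
theorem MemHk.exists_primitives {c d : ℝ} (hcd : c < d) {k n : ℕ} {u w : ℝ → ℂ}
    (h : MemHk (Ioo c d) n u) (hn : k + 1 ≤ n) (hw : HasWeakDeriv (Ioo c d) (k + 2) u w)
    (hi : IntegrableOn w (Ioo c d)) :
    ∃ F F' : ℝ → ℂ, IsPrimitive c d F F' ∧ IsPrimitive c d F' w ∧
      HasWeakDeriv (Ioo c d) k u F ∧ HasWeakDeriv (Ioo c d) (k + 1) u F' := by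
  obtain ⟨w₀, -, hd₀⟩ := h.exists_integrableOn ((Nat.le_succ k).trans hn)
  obtain ⟨w₁, -, hd₁⟩ := h.exists_integrableOn hn
  obtain ⟨F', hF', he'⟩ := hd₁.exists_isPrimitive_succ hcd hw hi
  have hd₁' := hd₁.congr_right he'
  obtain ⟨F, hF, he⟩ := hd₀.exists_isPrimitive_succ hcd hd₁'
    (((hF'.continuousOn hcd.le).integrableOn_compact isCompact_Icc).mono_set Ioo_subset_Icc_self)
  exact ⟨F, F', hF, hF', hd₀.congr_right he, hd₁'⟩

/-- Trace values do not depend on the representative: continuous functions equal almost everywhere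
on (c, d) agree on [c, d]. -/
theorem HasTrace.eq {c d : ℝ} (hcd : c < d) {j : ℕ} {u F : ℝ → ℂ} {x : ℝ} {y : ℂ}
    (h : HasTrace c d j u x y) (hF : HasWeakDeriv (Ioo c d) j u F)
    (hc : ContinuousOn F (Icc c d)) (hx : x ∈ Icc c d) : F x = y := by
  obtain ⟨g, hg, hd, rfl⟩ := h
  refine eqOn_of_ae_eq hcd hc hg ?_ hx
  rw [Filter.EventuallyEq, ae_restrict_iff' measurableSet_Ioo]
  exact hF.ae_unique isOpen_Ioo hd

theorem IsPrimitive.hasTrace {c d : ℝ} (hcd : c ≤ d) {j : ℕ} {u F f : ℝ → ℂ}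
    (hF : IsPrimitive c d F f) (h : HasWeakDeriv (Ioo c d) j u F) (x : ℝ) :
    HasTrace c d j u x (F x) :=
  ⟨F, hF.continuousOn hcd, h, rfl⟩

theorem HasTrace.mono {c d c' d' : ℝ} {j : ℕ} {u : ℝ → ℂ} {x : ℝ} {y : ℂ}
    (h : HasTrace c d j u x y) (h1 : c ≤ c') (h2 : d' ≤ d) : HasTrace c' d' j u x y := by
  obtain ⟨g, hg, hd, he⟩ := h
  exact ⟨g, hg.mono (Icc_subset_Icc h1 h2), hd.mono measurableSet_Ioo (Ioo_subset_Ioo h1 h2), he⟩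

theorem HasTrace.of_hasWeakDeriv {c d : ℝ} {j k : ℕ} {u w : ℝ → ℂ} {x : ℝ} {y : ℂ}
    (hu : HasWeakDeriv (Ioo c d) j u w) (h : HasTrace c d k w x y) : HasTrace c d (j + k) u x y := by
  obtain ⟨g, hg, hd, he⟩ := h
  exact ⟨g, hg, hu.comp hd, he⟩

theorem L2I.locallyIntegrableOn (u : L2I) : LocallyIntegrableOn u (Ioo 0 1) :=
  u.integrableOn.locallyIntegrableOn

theorem memLp_of_continuousOn {c d : ℝ} {F : ℝ → ℂ} (h : ContinuousOn F (Icc c d)) :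
    MemLp F 2 (volume.restrict (Ioo c d)) := by
  obtain ⟨M, hM⟩ := isCompact_Icc.exists_bound_of_continuousOn h
  refine MemLp.of_bound ((h.mono Ioo_subset_Icc_self).aestronglyMeasurable measurableSet_Ioo) M ?_
  filter_upwards [ae_restrict_mem measurableSet_Ioo] with x hx using hM x (Ioo_subset_Icc_self hx)

/-! ### The Dirichlet problem u'' = f -/

/-- `u` solves `u'' = f` on `(0, 1)` with `u(0) = u(1) = 0`. -/
structure IsDirichletSol (u f : L2I) : Prop where
  weak : HasWeakDeriv (Ioo 0 1) 2 u f
  memH2 : MemHk (Ioo 0 1) 2 u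
  zero : HasTrace 0 1 0 u 0 0
  one : HasTrace 0 1 0 u 1 0

namespace IsDirichletSol

variable {u f v g : L2I}

theorem exists_primitives (h : IsDirichletSol u f) : ∃ F F' : ℝ → ℂ, IsPrimitive 0 1 F F' ∧
    IsPrimitive 0 1 F' f ∧ HasWeakDeriv (Ioo 0 1) 0 u F ∧ HasWeakDeriv (Ioo 0 1) 1 u F' ∧
    F 0 = 0 ∧ F 1 = 0 := by
  obtain ⟨F, F', hF, hF', h0, h1⟩ := h.memH2.exists_primitives zero_lt_one (k := 0)
    one_le_two h.weak f.integrableOn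
  have hc := hF.continuousOn zero_le_one
  exact ⟨F, F', hF, hF', h0, h1, h.zero.eq zero_lt_one h0 hc (by simp),
    h.one.eq zero_lt_one h0 hc (by simp)⟩

theorem of_primitives {F F' : ℝ → ℂ} (hF : IsPrimitive 0 1 F F') (hF' : IsPrimitive 0 1 F' f)
    (h0 : F 0 = 0) (h1 : F 1 = 0) (hu : u =ᵐ[volume.restrict (Ioo 0 1)] F) :
    IsDirichletSol u f := by
  have d0 : HasWeakDeriv (Ioo 0 1) 0 u F :=
    (HasWeakDeriv.self u.locallyIntegrableOn).congr_right hu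
  have d1 := d0.comp (hF.hasWeakDeriv zero_le_one)
  have d2 := d1.comp (hF'.hasWeakDeriv zero_le_one)
  refine ⟨d2, fun j hj => ?_, h0 ▸ hF.hasTrace zero_le_one d0 0, h1 ▸ hF.hasTrace zero_le_one d0 1⟩
  interval_cases j
  · exact ⟨F, memLp_of_continuousOn (hF.continuousOn zero_le_one), d0⟩
  · exact ⟨F', memLp_of_continuousOn (hF'.continuousOn zero_le_one), d1⟩
  · exact ⟨f, Lp.memLp f, d2⟩

theorem exists_sol (f : L2I) : ∃ u, IsDirichletSol u f := by
  have hf : IntervalIntegrable f volume 0 1 :=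
    (intervalIntegrable_iff_integrableOn_Ioo_of_le zero_le_one).2 f.integrableOn
  have h1 : ∀ C, IsPrimitive 0 1 (fun x => C + ∫ t in (0 : ℝ)..x, f t) f := fun C =>
    IsPrimitive.of_integral hf C
  have hi : ∀ C, IntervalIntegrable (fun x => C + ∫ t in (0 : ℝ)..x, f t) volume 0 1 := fun C =>
    ((h1 C).ac zero_le_one).continuousOn.intervalIntegrable
  -- C is the initial slope, chosen so that the second primitive vanishes at 1.
  obtain ⟨C, hC⟩ : ∃ C : ℂ, ∫ x in (0 : ℝ)..1, (C + ∫ t in (0 : ℝ)..x, f t) = 0 := by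
    have hi0 := hi 0
    simp only [zero_add] at hi0
    refine ⟨-∫ x in (0 : ℝ)..1, ∫ t in (0 : ℝ)..x, f t, ?_⟩
    rw [intervalIntegral.integral_add intervalIntegrable_const hi0]
    simp
  have h2 := IsPrimitive.of_integral (hi C) 0
  have hm := memLp_of_continuousOn (h2.continuousOn zero_le_one)
  exact ⟨hm.toLp _, of_primitives h2 (h1 C) (by simp) (by simp [hC]) hm.coeFn_toLp⟩

theorem add (h : IsDirichletSol u f) (k : IsDirichletSol v g) : IsDirichletSol (u + v) (f + g) := by
  have e := L2I.coe_add (le_refl (Ioo (0 : ℝ) 1)) u v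
  exact ⟨(h.weak.add isOpen_Ioo k.weak).congr e (L2I.coe_add le_rfl f g),
    (h.memH2.add isOpen_Ioo k.memH2).congr e, by simpa using (h.zero.add k.zero).congr e,
    by simpa using (h.one.add k.one).congr e⟩

theorem smul (c : ℂ) (h : IsDirichletSol u f) : IsDirichletSol (c • u) (c • f) := by
  have e := L2I.coe_smul (le_refl (Ioo (0 : ℝ) 1)) c u
  exact ⟨(h.weak.smul c).congr e (L2I.coe_smul le_rfl c f),
    (h.memH2.smul c).congr e, by simpa using (h.zero.smul c).congr e,
    by simpa using (h.one.smul c).congr e⟩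

/-- Both sides equal -∫ conj(u') v', since the boundary terms vanish. -/
theorem inner_symm (h : IsDirichletSol u f) (k : IsDirichletSol v g) :
    inner ℂ f v = inner ℂ u g := by
  obtain ⟨F, F', hF, hF', dF, -, F0, F1⟩ := h.exists_primitives
  obtain ⟨G, G', hG, hG', dG, -, G0, G1⟩ := k.exists_primitives
  rw [L2I.inner_eq (Filter.EventuallyEq.refl _ _) (dG.eq_self isOpen_Ioo),
    L2I.inner_eq (dF.eq_self isOpen_Ioo) (Filter.EventuallyEq.refl _ _)]
  have hcont : ∀ {A B : ℝ → ℂ}, IsPrimitive 0 1 A B → ContinuousOn A (uIcc 0 1) := fun hA =>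
    (hA.ac zero_le_one).continuousOn
  have p1 := (hF'.conj.mul zero_le_one hG).integral_eq zero_le_one
  have p2 := (hF.conj.mul zero_le_one hG').integral_eq zero_le_one
  have ic := ((hcont hF'.conj).fun_mul (hcont hG')).intervalIntegrable (μ := volume)
  rw [intervalIntegral.integral_add (hF'.conj.integrable.mul_continuousOn (hcont hG)) ic, G0, G1]
    at p1
  rw [intervalIntegral.integral_add ic (hG'.integrable.continuousOn_mul (hcont hF.conj)), F0, F1]
    at p2
  simp only [map_zero, mul_zero, zero_mul, sub_zero] at p1 p2
  linear_combination p1 - p2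

/-- Integration by parts gives ∫‖u'‖² = -⟨f, u⟩; then Cauchy-Schwarz. -/
theorem integral_sq_le {F F' : ℝ → ℂ} (hF : IsPrimitive 0 1 F F')
    (hF' : IsPrimitive 0 1 F' f) (dF : HasWeakDeriv (Ioo 0 1) 0 u F) (F0 : F 0 = 0)
    (F1 : F 1 = 0) : ∫ x in (0 : ℝ)..1, ‖F' x‖ ^ 2 ≤ ‖f‖ * ‖u‖ := by
  have hcont : ∀ {A B : ℝ → ℂ}, IsPrimitive 0 1 A B → ContinuousOn A (uIcc 0 1) := fun hA =>
    (hA.ac zero_le_one).continuousOn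
  have p1 := (hF'.conj.mul zero_le_one hF).integral_eq zero_le_one
  have ic := ((hcont hF'.conj).fun_mul (hcont hF')).intervalIntegrable (μ := volume)
  rw [intervalIntegral.integral_add (hF'.conj.integrable.mul_continuousOn (hcont hF)) ic, F0, F1,
    ← L2I.inner_eq (Filter.EventuallyEq.refl _ _) (dF.eq_self isOpen_Ioo), integral_normSq_eq,
    mul_zero, mul_zero, sub_zero] at p1
  have e : ((∫ x in (0 : ℝ)..1, ‖F' x‖ ^ 2 : ℝ) : ℂ) = -inner ℂ f u := by
    linear_combination p1
  have hn := congrArg norm e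
  rw [norm_neg, Complex.norm_real] at hn
  exact (le_abs_self _).trans (hn.le.trans (norm_inner_le_norm f u))

/-- Wirtinger gives π²‖u‖² ≤ ∫‖u'‖² ≤ ‖f‖‖u‖. The sharp constant π² here is the source of aπ⁴ in the
final bounds. -/
theorem norm_le (h : IsDirichletSol u f) : Real.pi ^ 2 * ‖u‖ ≤ ‖f‖ := by
  obtain ⟨F, F', hF, hF', dF, -, F0, F1⟩ := h.exists_primitives
  have h1 := integral_sq_le hF hF' dF F0 F1
  have h2 := wirtinger hF (hF'.continuousOn zero_le_one) F0 F1
  rw [← L2I.norm_sq_eq (dF.eq_self isOpen_Ioo)] at h2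
  rcases (norm_nonneg u).eq_or_lt with h0 | h0
  · rw [← h0, mul_zero]; exact norm_nonneg f
  · refine le_of_mul_le_mul_right ?_ h0
    calc Real.pi ^ 2 * ‖u‖ * ‖u‖ = Real.pi ^ 2 * ‖u‖ ^ 2 := by ring
      _ ≤ ‖f‖ * ‖u‖ := h2.trans h1

theorem norm_le_norm (h : IsDirichletSol u f) : ‖u‖ ≤ ‖f‖ := by
  have h1 := h.norm_le
  have h2 : 1 ≤ Real.pi ^ 2 := by nlinarith [Real.pi_gt_three]
  nlinarith [norm_nonneg u]

theorem trace_sq_le (h : IsDirichletSol u f) {x : ℝ} (hx : x ∈ Icc (0 : ℝ) 1) {y : ℂ}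
    (hy : HasTrace 0 1 0 u x y) : ‖y‖ ^ 2 ≤ ‖f‖ ^ 2 := by
  obtain ⟨F, F', hF, hF', dF, -, F0, F1⟩ := h.exists_primitives
  have h1 := integral_sq_le hF hF' dF F0 F1
  have h2 := sq_norm_le_integral_sq hF (hF'.continuousOn zero_le_one) F0 hx
  rw [hy.eq zero_lt_one dF (hF.continuousOn zero_le_one) hx] at h2
  have h3 := mul_le_mul_of_nonneg_left h.norm_le_norm (norm_nonneg f)
  nlinarith

theorem unique {u' : L2I} (h : IsDirichletSol u f) (h' : IsDirichletSol u' f) : u = u' := by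
  have h1 := (h.add (h'.smul (-1))).norm_le_norm
  rw [neg_one_smul, neg_one_smul, add_neg_cancel, norm_zero, ← sub_eq_add_neg] at h1
  exact sub_eq_zero.1 (norm_le_zero_iff.1 h1)

end IsDirichletSol

/-- The solution operator of `u'' = f`, `u(0) = u(1) = 0`. -/
noncomputable def dirichletSol : L2I →L[ℂ] L2I :=
  LinearMap.mkContinuous
    { toFun := fun f => (IsDirichletSol.exists_sol f).choose
      map_add' := fun f g => (IsDirichletSol.exists_sol (f + g)).choose_spec.unique
        ((IsDirichletSol.exists_sol f).choose_spec.add (IsDirichletSol.exists_sol g).choose_spec)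
      map_smul' := fun c f => (IsDirichletSol.exists_sol (c • f)).choose_spec.unique
        ((IsDirichletSol.exists_sol f).choose_spec.smul c) }
    1 (fun f => by
      rw [one_mul]
      exact (IsDirichletSol.exists_sol f).choose_spec.norm_le_norm)

theorem isDirichletSol_dirichletSol (f : L2I) : IsDirichletSol (dirichletSol f) f :=
  (IsDirichletSol.exists_sol f).choose_spec

/-! ### Coercivity and the fourth-order equation -/

theorem exists_pos_le_norm {a l : ℂ} {r : ℝ} (h : ∀ θ ∈ Icc (0 : ℝ) r, a + l * θ ≠ 0) :
    ∃ δ > 0, ∀ θ ∈ Icc (0 : ℝ) r, δ ≤ ‖a + l * θ‖ := by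
  have hc : Continuous fun θ : ℝ => ‖a + l * θ‖ := by fun_prop
  rcases (Icc (0 : ℝ) r).eq_empty_or_nonempty with he | hne
  · exact ⟨1, one_pos, by simp [he]⟩
  · obtain ⟨θ, hθ, hmin⟩ := isCompact_Icc.exists_isMinOn hne hc.continuousOn
    exact ⟨_, norm_pos_iff.2 (h θ hθ), fun t ht => hmin ht⟩

/-- Factor out ‖q‖²: the ratio θ = ‖u‖²/‖q‖² lies in [0, π⁻⁴] by `norm_le`. -/
theorem IsDirichletSol.coercive {u q : L2I} (h : IsDirichletSol u q) {a l : ℂ} {δ : ℝ}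
    (hδ : ∀ θ ∈ Icc (0 : ℝ) (1 / Real.pi ^ 4), δ ≤ ‖a + l * θ‖) :
    δ * ‖q‖ ^ 2 ≤ ‖a * (‖q‖ : ℂ) ^ 2 + l * (‖u‖ : ℂ) ^ 2‖ := by
  rcases (norm_nonneg q).eq_or_lt with h0 | h0
  · rw [← h0]
    simp only [ne_eq, OfNat.ofNat_ne_zero, not_false_eq_true, zero_pow, mul_zero, norm_nonneg]
  · have hle := pow_le_pow_left₀ (by positivity) h.norm_le 2
    have := hδ (‖u‖ ^ 2 / ‖q‖ ^ 2) ⟨by positivity, by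
      rw [div_le_div_iff₀ (by positivity) (by positivity)]
      linarith⟩
    have hq : (‖q‖ : ℂ) ≠ 0 := by exact_mod_cast h0.ne'
    have e : a * (‖q‖ : ℂ) ^ 2 + l * (‖u‖ : ℂ) ^ 2
        = (a + l * ((‖u‖ ^ 2 / ‖q‖ ^ 2 : ℝ) : ℂ)) * (‖q‖ : ℂ) ^ 2 := by
      push_cast
      field_simp
    rw [e, norm_mul, norm_pow, Complex.norm_real, norm_norm]
    gcongr

/-- A Lax-Milgram argument: with S = `dirichletSol` symmetric, ⟨p, (a + lS²)p⟩ = a‖p‖² + l‖Sp‖²,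
which is coercive. The unknown p stands for u''''. -/
theorem exists_biharmonic_sol {a l : ℂ}
    (h : ∀ θ ∈ Icc (0 : ℝ) (1 / Real.pi ^ 4), a + l * θ ≠ 0) (g : L2I) :
    ∃ p : L2I, a • p + l • dirichletSol (dirichletSol p) = g := by
  obtain ⟨δ, hδ, hb⟩ := exists_pos_le_norm h
  have hu : IsUnit (a • (1 : L2I →L[ℂ] L2I) + l • (dirichletSol * dirichletSol)) := by
    refine ContinuousLinearMap.isUnit_of_forall_le_norm_inner_map _ (c := ⟨δ, hδ.le⟩) hδ fun p => ?_
    have e : inner ℂ p ((a • (1 : L2I →L[ℂ] L2I) + l • (dirichletSol * dirichletSol)) p)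
        = a * (‖p‖ : ℂ) ^ 2 + l * (‖dirichletSol p‖ : ℂ) ^ 2 := by
      have e1 := (isDirichletSol_dirichletSol p).inner_symm
        (isDirichletSol_dirichletSol (dirichletSol p))
      simp only [add_apply, smul_apply,
        mul_apply_eq_comp, one_apply_eq_self, inner_add_right,
        inner_smul_right]
      rw [e1, inner_self_eq_norm_sq_to_K, inner_self_eq_norm_sq_to_K]
      rfl
    rw [norm_inner_symm, e, mul_comm]
    exact (isDirichletSol_dirichletSol p).coercive hb
  obtain ⟨p, hp⟩ := (ContinuousLinearMap.isUnit_iff_bijective.1 hu).2 g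
  exact ⟨p, hp⟩

/-! ### Green's formula and the energy identity -/

/-- Two integrations by parts with all boundary terms kept, for use on each side of ξ. The functions
F, F', A, B, p play u, u', u'', u''', u'''', and q is another representative of u''. -/
theorem integral_conj_mul_eq {c d : ℝ} (hcd : c ≤ d) {F F' q A B p : ℝ → ℂ}
    (hF : IsPrimitive c d F F') (hF' : IsPrimitive c d F' q) (hA : IsPrimitive c d A B)
    (hB : IsPrimitive c d B p) (hq : q =ᵐ[volume.restrict (Ioo c d)] A) :
    ∫ x in c..d, starRingEnd ℂ (F x) * p x = (∫ x in c..d, starRingEnd ℂ (q x) * q x)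
      + (starRingEnd ℂ (F d) * B d - starRingEnd ℂ (F' d) * A d)
      - (starRingEnd ℂ (F c) * B c - starRingEnd ℂ (F' c) * A c) := by
  have hcont : ∀ {G g : ℝ → ℂ}, IsPrimitive c d G g → ContinuousOn G (uIcc c d) := fun hG =>
    (hG.ac hcd).continuousOn
  have p1 := (hF.conj.mul hcd hB).integral_eq hcd
  have p2 := (hF'.conj.mul hcd hA).integral_eq hcd
  have ic := ((hcont hF'.conj).fun_mul (hcont hB)).intervalIntegrable (μ := volume)
  rw [intervalIntegral.integral_add ic (hB.integrable.continuousOn_mul (hcont hF.conj))] at p1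
  rw [intervalIntegral.integral_add (hF'.conj.integrable.mul_continuousOn (hcont hA)) ic] at p2
  have e : ∫ x in c..d, starRingEnd ℂ (q x) * A x = ∫ x in c..d, starRingEnd ℂ (q x) * q x := by
    rw [intervalIntegral.integral_of_le hcd, intervalIntegral.integral_of_le hcd,
      integral_Ioc_eq_integral_Ioo, integral_Ioc_eq_integral_Ioo]
    refine integral_congr_ae ?_
    filter_upwards [hq] with x hx
    rw [hx]
  rw [e] at p2
  linear_combination p1 - p2

theorem InBeamDomain.isDirichletSol {a α ξ : ℝ} {u v q : L2I} (h : InBeamDomain a α ξ u v)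
    (hq : HasWeakDeriv (Ioo 0 1) 2 u q) : IsDirichletSol u q :=
  ⟨hq, h.u_H2, h.u_zero, h.u_one⟩

/-- Add Green's formula on (0, ξ) and (ξ, 1). The outer boundary terms vanish and the terms with u'
u'' cancel at ξ. What remains is -conj(u(ξ)) times the jump of u''', and the jump condition turns a
times it into α v(ξ) conj(u(ξ)). -/
theorem InBeamDomain.energy_identity {a α ξ : ℝ} (ha : a ≠ 0) (hξ : ξ ∈ Ioo (0 : ℝ) 1)
    {u v q p : L2I} (h : InBeamDomain a α ξ u v) (hq : HasWeakDeriv (Ioo 0 1) 2 u q)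
    (hp : IsFourthDeriv ξ u p) {y z : ℂ} (hy : HasTrace 0 1 0 u ξ y)
    (hz : HasTrace 0 1 0 v ξ z) :
    a * inner ℂ u p = a * (‖q‖ : ℂ) ^ 2 + α * z * starRingEnd ℂ y := by
  obtain ⟨F, F', hF, hF', dF, -, F0, F1⟩ := (h.isDirichletSol hq).exists_primitives
  have hFy := hy.eq zero_lt_one dF (hF.continuousOn zero_le_one) (Ioo_subset_Icc_self hξ)
  obtain ⟨A, A', hA, hA', dA, dA'⟩ := h.u_left.exists_primitives hξ.1 (k := 2)
    (by norm_num) hp.1 (p.integrableOn.mono_set (left_subset hξ))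
  obtain ⟨B, B', hB, hB', dB, dB'⟩ := h.u_right.exists_primitives hξ.2 (k := 2)
    (by norm_num) hp.2 (p.integrableOn.mono_set (right_subset hξ))
  have cA := hA.continuousOn hξ.1.le
  have cA' := hA'.continuousOn hξ.1.le
  have cB := hB.continuousOn hξ.2.le
  have cB' := hB'.continuousOn hξ.2.le
  have A0 := h.uxx_zero.eq hξ.1 dA cA (left_mem_Icc.2 hξ.1.le)
  have B1 := h.uxx_one.eq hξ.2 dB cB (right_mem_Icc.2 hξ.2.le)
  obtain ⟨m, hm1, hm2⟩ := h.uxx_cont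
  have Am := hm1.eq hξ.1 dA cA (right_mem_Icc.2 hξ.1.le)
  have Bm := hm2.eq hξ.2 dB cB (left_mem_Icc.2 hξ.2.le)
  obtain ⟨s, t, w, hs, ht, hw, hj⟩ := h.uxxx_jump
  have Bs := hs.eq hξ.2 dB' cB' (left_mem_Icc.2 hξ.2.le)
  have At := ht.eq hξ.1 dA' cA' (right_mem_Icc.2 hξ.1.le)
  have hwz : w = z := by
    obtain ⟨g, hg, hd, rfl⟩ := hz
    exact (hw.eq zero_lt_one hd hg (Ioo_subset_Icc_self hξ)).symm
  have hqA : q =ᵐ[volume.restrict (Ioo 0 ξ)] A := by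
    rw [Filter.EventuallyEq, ae_restrict_iff' measurableSet_Ioo]
    exact (hq.mono measurableSet_Ioo (left_subset hξ)).ae_unique isOpen_Ioo dA
  have hqB : q =ᵐ[volume.restrict (Ioo ξ 1)] B := by
    rw [Filter.EventuallyEq, ae_restrict_iff' measurableSet_Ioo]
    exact (hq.mono measurableSet_Ioo (right_subset hξ)).ae_unique isOpen_Ioo dB
  have e1 := integral_conj_mul_eq hξ.1.le (hF.mono zero_le_one le_rfl hξ.1.le hξ.2.le)
    (hF'.mono zero_le_one le_rfl hξ.1.le hξ.2.le) hA hA' hqA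
  have e2 := integral_conj_mul_eq hξ.2.le (hF.mono zero_le_one hξ.1.le hξ.2.le le_rfl)
    (hF'.mono zero_le_one hξ.1.le hξ.2.le le_rfl) hB hB' hqB
  have hsplit : ∀ {g : ℝ → ℂ}, IntegrableOn g (Ioo 0 1) →
      (∫ x in (0 : ℝ)..1, g x) = (∫ x in (0 : ℝ)..ξ, g x) + ∫ x in ξ..1, g x := by
    intro g hg
    have h1 := (intervalIntegrable_iff_integrableOn_Ioo_of_le hξ.1.le).2
      (hg.mono_set (left_subset hξ))
    have h2 := (intervalIntegrable_iff_integrableOn_Ioo_of_le hξ.2.le).2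
      (hg.mono_set (right_subset hξ))
    exact (intervalIntegral.integral_add_adjacent_intervals h1 h2).symm
  have i1 : IntegrableOn (fun x => starRingEnd ℂ (F x) * p x) (Ioo 0 1) :=
    (intervalIntegrable_iff_integrableOn_Ioo_of_le zero_le_one).1
      (((intervalIntegrable_iff_integrableOn_Ioo_of_le zero_le_one).2
        p.integrableOn).continuousOn_mul (hF.conj.ac zero_le_one).continuousOn)
  have i2 : IntegrableOn (fun x => starRingEnd ℂ (q x) * q x) (Ioo 0 1) := by
    refine (L2.integrable_inner (𝕜 := ℂ) q q).congr ?_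
    filter_upwards with x
    rw [RCLike.inner_apply, mul_comm]
  rw [L2I.inner_eq (dF.eq_self isOpen_Ioo) (Filter.EventuallyEq.refl _ _), hsplit i1, e1, e2]
  have e3 : ((‖q‖ : ℂ)) ^ 2 = ∫ x in (0 : ℝ)..1, starRingEnd ℂ (q x) * q x := by
    rw [← L2I.inner_eq (Filter.EventuallyEq.refl _ _) (Filter.EventuallyEq.refl _ _)]
    exact (inner_self_eq_norm_sq_to_K q).symm
  rw [e3, hsplit i2, F0, F1, A0, B1, Am, Bm, At, Bs, hFy]
  rw [hwz] at hj
  have ha' : (a : ℂ) ≠ 0 := by exact_mod_cast ha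
  have hj' : (a : ℂ) * (s - t) = -α * z := by
    rw [hj]
    field_simp
  simp only [map_zero, zero_mul, mul_zero, sub_zero]
  linear_combination (-starRingEnd ℂ y) * hj'

/-! ### The energy space and the undamped domain -/

theorem secondDeriv_spec {u : L2I} (h : MemHk (Ioo 0 1) 2 u) :
    HasWeakDeriv (Ioo 0 1) 2 u (secondDeriv u) := by
  have hex : ∃ w : L2I, HasWeakDeriv (Ioo 0 1) 2 u w := by
    obtain ⟨w, hw, hd⟩ := h 2 le_rfl
    exact ⟨hw.toLp w, hd.congr_right hw.coeFn_toLp.symm⟩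
  rw [secondDeriv, dif_pos hex]
  exact hex.choose_spec

theorem energyNorm_sq {a : ℝ} (ha : 0 ≤ a) (U : energySpace) :
    energyNorm a U ^ 2 = a * ‖secondDeriv U.1.1‖ ^ 2 + ‖U.1.2‖ ^ 2 := by
  have e : (energyInner a U U).re = a * ‖secondDeriv U.1.1‖ ^ 2 + ‖U.1.2‖ ^ 2 := by
    rw [energyInner, inner_self_eq_norm_sq_to_K, inner_self_eq_norm_sq_to_K]
    have : (a : ℂ) * ((‖secondDeriv U.1.1‖ : ℝ) : ℂ) ^ 2 + ((‖U.1.2‖ : ℝ) : ℂ) ^ 2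
        = ((a * ‖secondDeriv U.1.1‖ ^ 2 + ‖U.1.2‖ ^ 2 : ℝ) : ℂ) := by push_cast; rfl
    exact (congrArg Complex.re this).trans (Complex.ofReal_re _)
  rw [energyNorm, e, Real.sq_sqrt (by positivity)]

theorem energySpace_isDirichletSol (U : energySpace) :
    IsDirichletSol U.1.1 (secondDeriv U.1.1) :=
  ⟨secondDeriv_spec U.2.1, U.2.1, U.2.2.1, U.2.2.2⟩

theorem exists_trace {u : L2I} (h : MemHk (Ioo 0 1) 2 u) (x : ℝ) :
    ∃ y, HasTrace 0 1 0 u x y := by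
  obtain ⟨F, F', hF, hF', d0, d1⟩ := h.exists_primitives zero_lt_one (k := 0) one_le_two
    (secondDeriv_spec h) (secondDeriv u).integrableOn
  exact ⟨_, hF.hasTrace zero_le_one d0 x⟩

/-- At α = 0 the jump condition only asks u''' to be continuous at ξ, which holds because u'' = q is
itself in H² of the whole interval. Twofold Dirichlet solutions thus supply elements of the domain.
-/
theorem inBeamDomain_of_isDirichletSol {a ξ : ℝ} (hξ : ξ ∈ Ioo (0 : ℝ) 1) {u q p v : L2I}
    (hu : IsDirichletSol u q) (hq : IsDirichletSol q p) (h2 : MemHk (Ioo 0 1) 2 v)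
    (v0 : HasTrace 0 1 0 v 0 0) (v1 : HasTrace 0 1 0 v 1 0) : InBeamDomain a 0 ξ u v := by
  have hH4 : MemHk (Ioo 0 1) 4 u := by
    intro j hj
    rcases le_or_gt j 2 with h | h
    · exact hu.memH2 j h
    · obtain ⟨i, rfl⟩ := Nat.exists_eq_add_of_le h.le
      obtain ⟨w, hw, hd⟩ := hq.memH2 i (by omega)
      exact ⟨w, hw, hu.weak.comp hd⟩
  have hmono : ∀ {Ω : Set ℝ}, Ω ⊆ Ioo 0 1 → MemHk Ω 4 u := by
    intro Ω hΩ j hj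
    obtain ⟨w, hw, hd⟩ := hH4 j hj
    exact ⟨w, hw.mono_measure (Measure.restrict_mono hΩ le_rfl), hd.mono measurableSet_Ioo hΩ⟩
  obtain ⟨Q, Q', hQ, hQ', dQ, dQ', -, -⟩ := hq.exists_primitives
  have t2 := (hQ.hasTrace zero_le_one dQ ξ).of_hasWeakDeriv hu.weak
  have t3 := (hQ'.hasTrace zero_le_one dQ' ξ).of_hasWeakDeriv hu.weak
  obtain ⟨y, hy⟩ := exists_trace h2 ξ
  exact
  { u_left := hmono (left_subset hξ)
    u_right := hmono (right_subset hξ)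
    u_H2 := hu.memH2
    v_H2 := h2
    u_zero := hu.zero
    u_one := hu.one
    v_zero := v0
    v_one := v1
    uxx_zero := (hq.zero.of_hasWeakDeriv hu.weak).mono le_rfl hξ.2.le
    uxx_one := (hq.one.of_hasWeakDeriv hu.weak).mono hξ.1.le le_rfl
    uxx_cont := ⟨_, t2.mono le_rfl hξ.2.le, t2.mono hξ.1.le le_rfl⟩
    uxxx_jump := ⟨_, _, y, t3.mono hξ.1.le le_rfl, t3.mono le_rfl hξ.2.le, hy, by simp⟩ }

theorem isFourthDeriv_of_isDirichletSol {ξ : ℝ} (hξ : ξ ∈ Ioo (0 : ℝ) 1) {u q p : L2I}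
    (hu : IsDirichletSol u q) (hq : IsDirichletSol q p) : IsFourthDeriv ξ u p :=
  ⟨(hu.weak.comp hq.weak).mono measurableSet_Ioo (left_subset hξ),
    (hu.weak.comp hq.weak).mono measurableSet_Ioo (right_subset hξ)⟩

theorem exists_dirichlet_eigenfunction :
    ∃ u : L2I, u ≠ 0 ∧ IsDirichletSol u ((-(Real.pi : ℂ) ^ 2) • u) := by
  have d0 : ∀ x : ℝ, HasDerivAt (fun y : ℝ => Real.pi * y) Real.pi x := fun x => by
    simpa using (hasDerivAt_id x).const_mul Real.pi
  have h1 : IsPrimitive 0 1 (fun x => ((Real.sin (Real.pi * x) : ℝ) : ℂ))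
      (fun x => ((Real.cos (Real.pi * x) * Real.pi : ℝ) : ℂ)) :=
    IsPrimitive.of_hasDerivAt (fun x => (d0 x).sin.ofReal_comp) (by fun_prop)
  have h2 : IsPrimitive 0 1 (fun x => ((Real.cos (Real.pi * x) * Real.pi : ℝ) : ℂ))
      (fun x => ((-Real.sin (Real.pi * x) * Real.pi * Real.pi : ℝ) : ℂ)) :=
    IsPrimitive.of_hasDerivAt (fun x => ((d0 x).cos.mul_const Real.pi).ofReal_comp) (by fun_prop)
  have hc := h1.continuousOn zero_le_one
  have hm := memLp_of_continuousOn hc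
  refine ⟨hm.toLp _, fun h0 => ?_, IsDirichletSol.of_primitives h1 (h2.congr_ae zero_le_one ?_)
    (by simp) (by simp) hm.coeFn_toLp⟩
  · have e : (fun x : ℝ => ((Real.sin (Real.pi * x) : ℝ) : ℂ))
        =ᵐ[volume.restrict (Ioo 0 1)] fun _ => 0 := by
      have := hm.coeFn_toLp
      rw [h0] at this
      exact this.symm.trans (L2I.coe_zero le_rfl).symm
    have := eqOn_of_ae_eq zero_lt_one hc continuousOn_const e
      (show (1 / 2 : ℝ) ∈ Icc (0 : ℝ) 1 by constructor <;> norm_num)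
    simp only at this
    rw [show Real.pi * (1 / 2) = Real.pi / 2 by ring, Real.sin_pi_div_two] at this
    simp at this
  · filter_upwards [hm.coeFn_toLp, L2I.coe_smul le_rfl (-(Real.pi : ℂ) ^ 2) (hm.toLp _)]
      with x hx hx'
    rw [← hx', hx]
    push_cast
    ring

/-! ### Spectrum of the undamped operator -/

section Resolvent

variable {a b α ξ : ℝ} {hξ : ξ ∈ Ioo (0 : ℝ) 1} {μ : ℂ}

theorem IsEigenvalue.mem_spectrumOf {T : energySpace →ₗ.[ℂ] energySpace} (h : IsEigenvalue T μ) :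
    μ ∈ spectrumOf a T := by
  obtain ⟨U, hU, hT⟩ := h
  intro hres
  refine hU (hres.1.injective ?_)
  simp [hT]

/-- The eigenvector is (u, μu) with u = sin πx, for which u'''' = π⁴u. -/
theorem isEigenvalue_of_quadratic (hμ : μ ^ 2 + b * μ + a * (Real.pi : ℂ) ^ 4 = 0) :
    IsEigenvalue (beamOperator a b 0 ξ hξ) μ := by
  obtain ⟨u, hu0, hu⟩ := exists_dirichlet_eigenfunction
  have hq := hu.smul (-(Real.pi : ℂ) ^ 2)
  have hv := hu.smul μ
  let U : energySpace := ⟨(u, μ • u), hu.memH2, hu.zero, hu.one⟩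
  let V : beamDomain a 0 ξ hξ :=
    ⟨U, inBeamDomain_of_isDirichletSol hξ hu hq hv.memH2 hv.zero hv.one⟩
  refine ⟨V, fun h => hu0 ?_, ?_⟩
  · exact congrArg (fun W : beamDomain a 0 ξ hξ => W.1.1.1) h
  · have hp : fourthDeriv hξ V = _ :=
      (fourthDeriv_spec hξ V).unique (isFourthDeriv_of_isDirichletSol hξ hu hq)
    refine Subtype.ext (Prod.ext rfl ?_)
    refine (beamOperator_snd a b 0 ξ hξ V).trans ?_
    rw [hp]
    change -((a : ℂ) • (-(Real.pi : ℂ) ^ 2) • (-(Real.pi : ℂ) ^ 2) • u) - (b : ℂ) • μ • u = μ • μ • u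
    simp only [smul_smul, ← neg_smul, ← sub_smul]
    congr 1
    linear_combination (-1 : ℂ) * hμ

/-- Eliminating v = μu - F₁ leaves a u'''' + μ(μ+b)u = F₂ + (μ+b)F₁. Pair with u, apply the energy
identity at α = 0 and coercivity, then divide by ‖u''‖ using ‖u‖ ≤ ‖u''‖. -/
theorem beam_resolvent_estimate (ha : 0 < a) {δ : ℝ}
    (hδ : ∀ θ ∈ Icc (0 : ℝ) (1 / Real.pi ^ 4), δ ≤ ‖(a : ℂ) + μ * (μ + b) * θ‖)
    (U : (beamOperator a b 0 ξ hξ).domain) {F : energySpace}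
    (hF : μ • (U : energySpace) - beamOperator a b 0 ξ hξ U = F) :
    δ * ‖secondDeriv U.1.1.1‖ ≤ ‖F.1.2 + (μ + b) • F.1.1‖ ∧ U.1.1.2 = μ • U.1.1.1 - F.1.1 := by
  have hU : InBeamDomain a 0 ξ U.1.1.1 U.1.1.2 := U.2
  set p := fourthDeriv hξ U
  have hF1 : F.1.1 = μ • U.1.1.1 - U.1.1.2 := by rw [← hF]; rfl
  have hF2 : F.1.2 = μ • U.1.1.2 - (-((a : ℂ) • p) - (b : ℂ) • U.1.1.2) := by rw [← hF]; rfl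
  refine ⟨?_, by rw [hF1, sub_sub_cancel]⟩
  have hq := energySpace_isDirichletSol U.1
  set q := secondDeriv U.1.1.1
  have hh : F.1.2 + (μ + b) • F.1.1 = (a : ℂ) • p + (μ * (μ + b)) • U.1.1.1 := by
    rw [hF1, hF2]
    module
  obtain ⟨y, hy⟩ := exists_trace hU.u_H2 ξ
  obtain ⟨z, hz⟩ := exists_trace hU.v_H2 ξ
  have hid := hU.energy_identity ha.ne' hξ hq.weak (fourthDeriv_spec hξ U) hy hz
  have hin : inner ℂ U.1.1.1 (F.1.2 + (μ + b) • F.1.1)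
      = (a : ℂ) * (‖q‖ : ℂ) ^ 2 + μ * (μ + b) * (‖U.1.1.1‖ : ℂ) ^ 2 := by
    rw [hh, inner_add_right, inner_smul_right, inner_smul_right, hid, inner_self_eq_norm_sq_to_K]
    simp
  have h1 := hq.coercive hδ
  rw [← hin] at h1
  have h2 := h1.trans (norm_inner_le_norm _ _)
  rcases (norm_nonneg q).eq_or_lt with h0 | h0
  · rw [← h0, mul_zero]; exact norm_nonneg _
  · refine le_of_mul_le_mul_right ?_ h0
    have h3 := mul_le_mul_of_nonneg_right hq.norm_le_norm
      (norm_nonneg (F.1.2 + (μ + b) • F.1.1))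
    linarith

/-- The estimate gives injectivity and the bounded inverse. For surjectivity, solve for p = u'''',
apply the Dirichlet inverse twice to get u, and put v = μu - F₁. -/
theorem mem_resolventSetOf_beamOperator (ha : 0 < a)
    (h : ∀ θ ∈ Icc (0 : ℝ) (1 / Real.pi ^ 4), (a : ℂ) + μ * (μ + b) * θ ≠ 0) :
    μ ∈ resolventSetOf a (beamOperator a b 0 ξ hξ) := by
  obtain ⟨δ, hδ, hb⟩ := exists_pos_le_norm h
  refine ⟨⟨fun U V hUV => ?_, fun F => ?_⟩, ?_⟩
  · have h0 : μ • ((U - V : (beamOperator a b 0 ξ hξ).domain) : energySpace)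
        - beamOperator a b 0 ξ hξ (U - V) = 0 := by
      rw [LinearPMap.map_sub, Submodule.coe_sub, smul_sub]
      have hUV' := sub_eq_zero.2 hUV
      simp only at hUV'
      rw [← hUV']
      abel
    obtain ⟨h1, h2⟩ := beam_resolvent_estimate ha hb (U - V) h0
    have e1 : ‖secondDeriv (U - V).1.1.1‖ ≤ 0 := by
      have e0 : ((0 : energySpace).1.2 + (μ + b) • (0 : energySpace).1.1 : L2I) = 0 := by simp
      rw [e0, norm_zero] at h1
      exact nonpos_of_mul_nonpos_right h1 hδ
    have e2 : (U - V).1.1.1 = 0 :=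
      norm_le_zero_iff.1 ((energySpace_isDirichletSol (U - V).1).norm_le_norm.trans e1)
    have e3 : (U - V).1.1.2 = 0 := by
      rw [h2, e2]; simp
    exact sub_eq_zero.1 (Subtype.ext (Subtype.ext (Prod.ext e2 e3)))
  · obtain ⟨p, hp⟩ := exists_biharmonic_sol h (F.1.2 + (μ + b) • F.1.1)
    have hq := isDirichletSol_dirichletSol p
    have hu := isDirichletSol_dirichletSol (dirichletSol p)
    set q := dirichletSol p
    set u := dirichletSol q
    have hv := (hu.smul μ).add ((energySpace_isDirichletSol F).smul (-1))
    let U : energySpace := ⟨(u, μ • u + (-1 : ℂ) • F.1.1), hu.memH2, hu.zero, hu.one⟩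
    let V : beamDomain a 0 ξ hξ :=
      ⟨U, inBeamDomain_of_isDirichletSol hξ hu hq hv.memH2 hv.zero hv.one⟩
    have hV : fourthDeriv hξ V = p :=
      (fourthDeriv_spec hξ V).unique (isFourthDeriv_of_isDirichletSol hξ hu hq)
    refine ⟨V, Subtype.ext (Prod.ext ?_ ?_)⟩
    · change μ • u - (μ • u + (-1 : ℂ) • F.1.1) = F.1.1
      module
    · change μ • (μ • u + (-1 : ℂ) • F.1.1)
        - (-((a : ℂ) • fourthDeriv hξ V) - (b : ℂ) • (μ • u + (-1 : ℂ) • F.1.1)) = F.1.2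
      rw [hV, ← sub_eq_zero]
      rw [← sub_eq_zero] at hp
      rw [← hp]
      module
  -- K bounds ‖u''‖ by the energy norm of F, since ‖F₂‖ ≤ ‖F‖ and ‖F₁‖ ≤ ‖F₁''‖ ≤ ‖F‖/√a.
  · set K : ℝ := (1 + ‖μ + b‖ / √a) / δ
    have hsa : 0 < √a := Real.sqrt_pos.2 ha
    refine ⟨√a * K + (‖μ‖ * K + 1 / √a), fun U => ?_⟩
    obtain ⟨h1, h2⟩ := beam_resolvent_estimate ha hb U rfl
    set F := μ • (U : energySpace) - beamOperator a b 0 ξ hξ U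
    have hN0 : 0 ≤ energyNorm a F := Real.sqrt_nonneg _
    have hN := energyNorm_sq ha.le F
    set N := energyNorm a F
    have hsq : √a ^ 2 = a := Real.sq_sqrt ha.le
    have hg : ‖F.1.2‖ ≤ N := by
      refine le_of_sq_le_sq ?_ hN0
      rw [hN]
      have : 0 ≤ a * ‖secondDeriv F.1.1‖ ^ 2 := by positivity
      linarith
    have hf : ‖F.1.1‖ ≤ N / √a := by
      refine (energySpace_isDirichletSol F).norm_le_norm.trans ?_
      rw [le_div_iff₀ hsa]
      refine le_of_sq_le_sq ?_ hN0
      rw [hN, mul_pow, hsq]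
      have : 0 ≤ ‖F.1.2‖ ^ 2 := by positivity
      linarith
    have hq : ‖secondDeriv U.1.1.1‖ ≤ K * N := by
      have h3 : ‖F.1.2 + (μ + b) • F.1.1‖ ≤ N + ‖μ + b‖ * (N / √a) := by
        refine (norm_add_le _ _).trans (add_le_add hg ?_)
        rw [norm_smul]
        gcongr
      have e : K * N = (N + ‖μ + b‖ * (N / √a)) / δ := by
        simp only [K]
        field_simp
      rw [e, le_div_iff₀ hδ, mul_comm]
      exact h1.trans h3
    have hv : ‖U.1.1.2‖ ≤ ‖μ‖ * (K * N) + N / √a := by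
      rw [h2]
      refine (norm_sub_le _ _).trans (add_le_add ?_ hf)
      rw [norm_smul]
      gcongr
      exact (energySpace_isDirichletSol U.1).norm_le_norm.trans hq
    have hE : energyNorm a U.1 ≤ √a * ‖secondDeriv U.1.1.1‖ + ‖U.1.1.2‖ := by
      refine le_of_sq_le_sq ?_ (by positivity)
      rw [energyNorm_sq ha.le, add_sq, mul_pow, hsq]
      have : 0 ≤ 2 * (√a * ‖secondDeriv U.1.1.1‖) * ‖U.1.1.2‖ := by positivity
      linarith
    calc energyNorm a U.1 ≤ √a * (K * N) + (‖μ‖ * (K * N) + N / √a) := by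
          refine hE.trans (add_le_add ?_ hv)
          gcongr
      _ = _ := by ring

/-- If the symbol vanished, its imaginary part would force μ to be real, as 2 Re μ + b > 0. Its real
part is then at least θ(μ² + bμ + aπ⁴) > 0, because θπ⁴ ≤ 1. Hypothesis `h2` covers both damping
regimes at once, and its square gives the margin ε² for small α. -/
theorem beam_symbol_ne_zero {κ : ℝ} (ha : 0 < a) (h1 : -b / 2 ≤ κ)
    (h2 : ∀ x, κ < x → (x - κ) ^ 2 ≤ x ^ 2 + b * x + a * Real.pi ^ 4) (hμ : κ < μ.re) :
    ∀ θ ∈ Icc (0 : ℝ) (1 / Real.pi ^ 4), (a : ℂ) + μ * (μ + b) * θ ≠ 0 := by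
  intro θ hθ h0
  have hre := congrArg Complex.re h0
  have him := congrArg Complex.im h0
  simp only [Complex.add_re, Complex.mul_re, Complex.ofReal_re, Complex.add_im, Complex.mul_im,
    Complex.ofReal_im, Complex.zero_re, Complex.zero_im] at hre him
  have hpi : 0 < Real.pi ^ 4 := by positivity
  have hθ0 : 0 < θ := by
    refine lt_of_le_of_ne hθ.1 fun h => ?_
    rw [← h] at hre
    simp only [mul_zero, sub_zero, add_zero] at hre
    exact ha.ne' hre
  have hθ1 : θ * Real.pi ^ 4 ≤ 1 := by rw [← le_div_iff₀ hpi]; exact hθ.2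
  have hy : μ.im = 0 := by
    have : μ.im * ((2 * μ.re + b) * θ) = 0 := by linarith
    refine (mul_eq_zero.1 this).resolve_right (mul_pos ?_ hθ0).ne'
    linarith
  rw [hy] at hre
  have hpos : 0 < μ.re ^ 2 + b * μ.re + a * Real.pi ^ 4 :=
    lt_of_lt_of_le (pow_pos (sub_pos.2 hμ) 2) (h2 _ hμ)
  have h3 := mul_pos hpos hθ0
  have h4 := mul_le_mul_of_nonneg_left hθ1 ha.le
  linarith

theorem isLUB_re_spectrumOf_beamOperator {κ : ℝ} (ha : 0 < a) (h1 : -b / 2 ≤ κ)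
    (h2 : ∀ x, κ < x → (x - κ) ^ 2 ≤ x ^ 2 + b * x + a * Real.pi ^ 4)
    (hμ : μ ^ 2 + b * μ + a * (Real.pi : ℂ) ^ 4 = 0) (hre : μ.re = κ) :
    IsLUB (Complex.re '' spectrumOf a (beamOperator a b 0 ξ hξ)) κ := by
  refine ⟨?_, fun s hs => ?_⟩
  · rintro _ ⟨z, hz, rfl⟩
    by_contra hlt
    exact hz (mem_resolventSetOf_beamOperator ha (beam_symbol_ne_zero ha h1 h2 (not_le.1 hlt)))
  · exact hs ⟨μ, (isEigenvalue_of_quadratic hμ).mem_spectrumOf, hre⟩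

/-! ### Eigenvalues of the pointwise damped operator -/

/-- Here N = ‖u‖², Q = ‖u''‖² and s = |u(ξ)|². An eigenvector has v = μu, so the point term of the
energy identity becomes αμs. -/
theorem eigenvalue_identity (ha : 0 < a) (h : IsEigenvalue (beamOperator a b α ξ hξ) μ) :
    ∃ N Q s : ℝ, 0 < N ∧ Real.pi ^ 4 * N ≤ Q ∧ 0 ≤ s ∧ s ≤ Q ∧
      (a : ℂ) * Q + α * μ * s + μ * (μ + b) * N = 0 := by
  obtain ⟨U, hU0, hT⟩ := h
  have hU : InBeamDomain a α ξ U.1.1.1 U.1.1.2 := U.2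
  have hq := energySpace_isDirichletSol U.1
  have hv : U.1.1.2 = μ • U.1.1.1 := congrArg (fun W : energySpace => W.1.1) hT
  have hp : -((a : ℂ) • fourthDeriv hξ U) - (b : ℂ) • U.1.1.2 = μ • U.1.1.2 :=
    congrArg (fun W : energySpace => W.1.2) hT
  obtain ⟨y, hy⟩ := exists_trace hU.u_H2 ξ
  have hz : HasTrace 0 1 0 U.1.1.2 ξ (μ * y) := by
    rw [hv]
    exact (hy.smul μ).congr (L2I.coe_smul le_rfl _ _)
  have hid := hU.energy_identity ha.ne' hξ hq.weak (fourthDeriv_spec hξ U) hy hz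
  have hne : U.1.1.1 ≠ 0 := by
    intro h0
    rw [h0, smul_zero] at hv
    exact hU0 (Subtype.ext (Subtype.ext (Prod.ext h0 hv)))
  have hp' : (a : ℂ) • fourthDeriv hξ U = (-(μ * (μ + b))) • U.1.1.1 := by
    rw [hv] at hp
    have : (a : ℂ) • fourthDeriv hξ U = -(b : ℂ) • μ • U.1.1.1 - μ • μ • U.1.1.1 := by
      rw [← hp]
      module
    rw [this]
    module
  have e := congrArg (fun w => inner ℂ U.1.1.1 w) hp'
  simp only [inner_smul_right] at e
  rw [hid, inner_self_eq_norm_sq_to_K] at e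
  refine ⟨‖U.1.1.1‖ ^ 2, ‖secondDeriv U.1.1.1‖ ^ 2, ‖y‖ ^ 2, by positivity, ?_, by positivity,
    hq.trace_sq_le (Ioo_subset_Icc_self hξ) hy, ?_⟩
  · calc Real.pi ^ 4 * ‖U.1.1.1‖ ^ 2 = (Real.pi ^ 2 * ‖U.1.1.1‖) ^ 2 := by ring
      _ ≤ _ := pow_le_pow_left₀ (by positivity) hq.norm_le 2
  · have hyy : y * starRingEnd ℂ y = (‖y‖ : ℂ) ^ 2 := by
      rw [Complex.mul_conj, Complex.normSq_eq_norm_sq]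
      push_cast
      rfl
    push_cast
    simp only [Complex.coe_algebraMap] at e
    linear_combination e - α * μ * hyy

/-- If Re μ > κ + ε, then μ is real and μ + b > 0, so αμs ≥ -αbQ. Absorbing this into aQ and using
π⁴N ≤ Q leaves (μ² + bμ + aπ⁴ - αbπ⁴)N ≤ 0, against μ² + bμ + aπ⁴ ≥ ε² > αbπ⁴. -/
theorem re_le_of_isEigenvalue {κ ε : ℝ} (ha : 0 < a) (hb : 0 < b) (h1 : -b / 2 ≤ κ)
    (h2 : ∀ x, κ < x → (x - κ) ^ 2 ≤ x ^ 2 + b * x + a * Real.pi ^ 4) (hε : 0 < ε) (hα : 0 < α)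
    (hα1 : α * b < a) (hα2 : α * b * Real.pi ^ 4 < ε ^ 2)
    (h : IsEigenvalue (beamOperator a b α ξ hξ) μ) : μ.re ≤ κ + ε := by
  obtain ⟨N, Q, s, hN, hQ, hs, hsQ, e⟩ := eigenvalue_identity ha h
  have hre := congrArg Complex.re e
  have him := congrArg Complex.im e
  simp only [Complex.add_re, Complex.mul_re, Complex.ofReal_re, Complex.add_im, Complex.mul_im,
    Complex.ofReal_im, Complex.zero_re, Complex.zero_im] at hre him
  by_contra! hx
  have hy : μ.im = 0 := by
    have : μ.im * (α * s + (2 * μ.re + b) * N) = 0 := by linarith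
    refine (mul_eq_zero.1 this).resolve_right ?_
    have : 0 < (2 * μ.re + b) * N := mul_pos (by linarith) hN
    positivity
  rw [hy] at hre
  have hpi : 0 < Real.pi ^ 4 := by positivity
  have hQ0 : 0 < Q := lt_of_lt_of_le (mul_pos hpi hN) hQ
  have h3 := h2 μ.re (by linarith)
  have h4 : ε ^ 2 ≤ (μ.re - κ) ^ 2 := pow_le_pow_left₀ hε.le (by linarith) 2
  have h5 : -(α * b * Q) ≤ α * μ.re * s := by
    have k1 : 0 ≤ α * s * (μ.re + b) := mul_nonneg (mul_nonneg hα.le hs) (by linarith)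
    have k2 : 0 ≤ α * b * (Q - s) := mul_nonneg (mul_nonneg hα.le hb.le) (by linarith)
    linarith
  have h6 : (a - α * b) * (Real.pi ^ 4 * N) ≤ (a - α * b) * Q :=
    mul_le_mul_of_nonneg_left hQ (by linarith)
  have h7 : 0 < (μ.re ^ 2 + b * μ.re + a * Real.pi ^ 4 - α * b * Real.pi ^ 4) * N :=
    mul_pos (by linarith) hN
  linarith

theorem exists_forall_re_le_of_isEigenvalue {κ ε : ℝ} (ha : 0 < a) (hb : 0 < b) (h1 : -b / 2 ≤ κ)
    (h2 : ∀ x, κ < x → (x - κ) ^ 2 ≤ x ^ 2 + b * x + a * Real.pi ^ 4) (hε : 0 < ε) :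
    ∃ α₀ : ℝ, 0 < α₀ ∧ ∀ α : ℝ, 0 < α → α < α₀ →
      ∀ μ : ℂ, IsEigenvalue (beamOperator a b α ξ hξ) μ → μ.re ≤ κ + ε := by
  have hpi : 0 < Real.pi ^ 4 := by positivity
  refine ⟨min (a / b) (ε ^ 2 / (b * Real.pi ^ 4)), by positivity, fun α hα hlt μ hμ => ?_⟩
  refine re_le_of_isEigenvalue ha hb h1 h2 hε hα
    ((lt_div_iff₀ hb).1 (hlt.trans_le (min_le_left _ _))) ?_ hμ
  rw [mul_assoc]
  exact (lt_div_iff₀ (by positivity)).1 (hlt.trans_le (min_le_right _ _))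

end Resolvent

/-! ### The two regimes of b -/

theorem mainTheorem3 (a b ξ : ℝ) (ha : 0 < a) (hb : 0 < b) (hξ : ξ ∈ Set.Ioo (0 : ℝ) 1)
    (hirr : Irrational ξ) :
    (b ≤ 2 * Real.sqrt a * Real.pi ^ 2 →
      IsLUB (Complex.re '' spectrumOf a (beamOperator a b 0 ξ hξ)) (-b / 2)) ∧
    (2 * Real.sqrt a * Real.pi ^ 2 < b →
      IsLUB (Complex.re '' spectrumOf a (beamOperator a b 0 ξ hξ))
        ((-b + Real.sqrt (b ^ 2 - 4 * a * Real.pi ^ 4)) / 2)) ∧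
    (∀ ε : ℝ, 0 < ε → ∃ α₀ : ℝ, 0 < α₀ ∧ ∀ α : ℝ, 0 < α → α < α₀ →
      ∀ μ : ℂ, IsEigenvalue (beamOperator a b α ξ hξ) μ →
        (b ≤ 2 * Real.sqrt a * Real.pi ^ 2 → μ.re ≤ -b / 2 + ε) ∧
        (2 * Real.sqrt a * Real.pi ^ 2 < b →
          μ.re ≤ (-b + Real.sqrt (b ^ 2 - 4 * a * Real.pi ^ 4)) / 2 + ε)) := by
  have hsq : (2 * √a * Real.pi ^ 2) ^ 2 = 4 * a * Real.pi ^ 4 := by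
    rw [mul_pow, mul_pow, Real.sq_sqrt ha.le]; ring
  rcases le_or_gt b (2 * √a * Real.pi ^ 2) with hle | hlt
  · have hD : b ^ 2 ≤ 4 * a * Real.pi ^ 4 := hsq ▸ pow_le_pow_left₀ hb.le hle 2
    -- The two sides differ by aπ⁴ - b²/4 ≥ 0.
    have h2 : ∀ x, -b / 2 < x → (x - -b / 2) ^ 2 ≤ x ^ 2 + b * x + a * Real.pi ^ 4 := by
      intro x _
      linarith
    refine ⟨fun _ => ?_, fun h => absurd h (not_lt.2 hle), fun ε hε => ?_⟩
    · have hr : ((√(a * Real.pi ^ 4 - b ^ 2 / 4) : ℝ) : ℂ) ^ 2 = a * (Real.pi : ℂ) ^ 4 - b ^ 2 / 4 := by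
        have := Real.sq_sqrt (show 0 ≤ a * Real.pi ^ 4 - b ^ 2 / 4 by linarith)
        exact_mod_cast congrArg (fun r : ℝ => (r : ℂ)) this
      refine isLUB_re_spectrumOf_beamOperator ha le_rfl h2
        (μ := ((-b / 2 : ℝ) : ℂ) + (√(a * Real.pi ^ 4 - b ^ 2 / 4) : ℝ) * Complex.I) ?_ (by simp)
      push_cast
      linear_combination (((√(a * Real.pi ^ 4 - b ^ 2 / 4) : ℝ) : ℂ) ^ 2) * Complex.I_sq - hr
    · obtain ⟨α₀, hα₀, H⟩ := exists_forall_re_le_of_isEigenvalue (hξ := hξ) ha hb le_rfl h2 hε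
      exact ⟨α₀, hα₀, fun α h0 h1 μ hμ =>
        ⟨fun _ => H α h0 h1 μ hμ, fun h => absurd h (not_lt.2 hle)⟩⟩
  · have hD : 0 < b ^ 2 - 4 * a * Real.pi ^ 4 := by
      rw [← hsq, sub_pos]
      exact pow_lt_pow_left₀ hlt (by positivity) two_ne_zero
    have hr := Real.sq_sqrt hD.le
    have hr0 := Real.sqrt_nonneg (b ^ 2 - 4 * a * Real.pi ^ 4)
    set r := √(b ^ 2 - 4 * a * Real.pi ^ 4)
    have h1 : -b / 2 ≤ (-b + r) / 2 := by linarith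
    -- With κ = (-b + r)/2 the quadratic factors as (x - κ)(x - κ + r), so the two sides differ by
    -- r(x - κ) ≥ 0.
    have h2 : ∀ x, (-b + r) / 2 < x →
        (x - (-b + r) / 2) ^ 2 ≤ x ^ 2 + b * x + a * Real.pi ^ 4 := by
      intro x hx
      have := mul_nonneg (sub_nonneg.2 hx.le) hr0
      linarith
    refine ⟨fun h => absurd hlt (not_lt.2 h), fun _ => ?_, fun ε hε => ?_⟩
    · refine isLUB_re_spectrumOf_beamOperator ha h1 h2 (μ := (((-b + r) / 2 : ℝ) : ℂ)) ?_
        (Complex.ofReal_re _)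
      have : ((-b + r) / 2) ^ 2 + b * ((-b + r) / 2) + a * Real.pi ^ 4 = 0 := by linarith
      exact_mod_cast congrArg (fun r : ℝ => (r : ℂ)) this
    · obtain ⟨α₀, hα₀, H⟩ := exists_forall_re_le_of_isEigenvalue (hξ := hξ) ha hb h1 h2 hε
      exact ⟨α₀, hα₀, fun α k0 k1 μ hμ =>
        ⟨fun h => absurd hlt (not_lt.2 h), fun _ => H α k0 k1 μ hμ⟩⟩
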